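/- Let $M=(m_{ij})$ be a $k\times k$ real symmetric positive-definite matrix with $m_{ii}=1$ for all $i$, and let $X=(X_1,\dots,X_k)$ be a $kn$-dimensional Gaussian vector (each $X_i$ in $\mathbb{R}^n$) with mean zero and covariance $M\otimes I_n$. Let $\Psi:[0,1]^k\to\mathbb{R}$ be continuous on $[0,1]^k$ and $C^2$ on $(0,1)^k$, with Hessian matrix $H_\Psi$ such that $M\odot H_\Psi(x)$ is negative semidefinite for every $x\in(0,1)^k$, where $\odot$ is the entrywise product. Let $f_1,\dots,f_k:\mathbb{R}^n\to[0,1]$ be measurable. Let $P_t$ be the Ornstein--Uhlenbeck semigroup on $\mathbb{R}^d$ ($d=n$ or $d=kn$), $(P_tf)(x)=\int_{\mathbb{R}^d} f(e^{-t}x+\sqrt{1-e^{-2t}}\,y)\,d\gamma_d(y)$, where $\gamma_d$ is the standard Gaussian measure. Let $Q$ be the positive-definite square root of $M\otimes I_n$, let $Q_i$ be the $n\times kn$ matrix formed by rows $(i-1)n+1,\dots,in$ of $Q$, write $g^{A}=g\circ A$ for a matrix $A$, and put $P_tF^Q=(P_t f_1^{Q_1},\dots,P_t f_k^{Q_k}):\mathbb{R}^{kn}\to[0,1]^k$.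 Suppose that $\mathbb{E}\,\Psi(f_1(X_1),\dots,f_k(X_k))=\Psi(\mathbb{E}f_1(X_1),\dots,\mathbb{E}f_k(X_k))$. Then for every $t>0$ the functions $P_tf_i$ are differentiable, and \[ \big((M\odot H_\Psi(P_tF^Q))\otimes I_n\big)\begin{pmatrix}(\nabla P_tf_1)^{Q_1}\\ \vdots\\ (\nabla P_tf_k)^{Q_k}\end{pmatrix}=0 \] at every point $z\in\mathbb{R}^{kn}$ at which $H_\Psi(P_tF^Q(z))$ is defined, that is, at every $z$ for which $P_tF^Q(z)\in(0,1)^k$ or, more generally, for which $\Psi$ is $C^2$, as a function on $[0,1]^k$ (with one-sided derivatives at the boundary), in a neighbourhood of $P_tF^Q(z)$. In particular the identity holds at every $z\in\mathbb{R}^{kn}$ if no $f_i$ is almost everywhere equal to $0$ or almost everywhere equal to $1$, and also if $\Psi$ is $C^2$ on the closed cube $[0,1]^k$. -/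

import Mathlib

open MeasureTheory ProbabilityTheory
open scoped Matrix Kronecker

noncomputable section

/-- `(P_t f)(x) = ∫ f (e^{-t} x + √(1 - e^{-2t}) y) dγ(y)`, the Ornstein-Uhlenbeck semigroup on
`ℝ^ι`, where `γ` is the standard Gaussian measure. -/
def ouSemigroup {ι : Type*} [Fintype ι] (t : ℝ) (f : EuclideanSpace ℝ ι → ℝ)
    (x : EuclideanSpace ℝ ι) : ℝ :=
  ∫ y, f (Real.exp (-t) • x + Real.sqrt (1 - Real.exp (-2 * t)) • y)
    ∂(stdGaussian (EuclideanSpace ℝ ι))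

/-- The closed cube `[0,1]^k`. -/
def unitCube (k : ℕ) : Set (Fin k → ℝ) := {x | ∀ i, x i ∈ Set.Icc (0 : ℝ) 1}

/-- The open cube `(0,1)^k`. -/
def openUnitCube (k : ℕ) : Set (Fin k → ℝ) := {x | ∀ i, x i ∈ Set.Ioo (0 : ℝ) 1}

/-- The Hessian matrix `(∂²Ψ/∂x_i∂x_j)(x)` of a function on `[0,1]^k`. Derivatives are taken within
the cube: at points of the open cube they are the usual ones, at boundary points the one-sided
ones, and only the values of `Ψ` on the cube matter. -/
def cubeHessian {k : ℕ} (Ψ : (Fin k → ℝ) → ℝ) (x : Fin k → ℝ) : Matrix (Fin k) (Fin k) ℝ :=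
  Matrix.of fun i j =>
    iteratedFDerivWithin ℝ 2 Ψ (unitCube k) x ![Pi.single i 1, Pi.single j 1]

/-- The `i`-th `n`-dimensional block `x_i` of `x = (x_1, …, x_k) ∈ ℝ^{kn}`. -/
def block {k n : ℕ} (i : Fin k) (x : EuclideanSpace ℝ (Fin k × Fin n)) :
    EuclideanSpace ℝ (Fin n) :=
  WithLp.toLp 2 fun a => x (i, a)

/-- The `n × kn` matrix `Q_i` formed by the `i`-th block of `n` rows of a `kn × kn` matrix `Q`. -/
def rowBlock {k n : ℕ} (Q : Matrix (Fin k × Fin n) (Fin k × Fin n) ℝ) (i : Fin k) :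
    Matrix (Fin n) (Fin k × Fin n) ℝ :=
  Q.submatrix (fun a => (i, a)) id

/-- The action `z ↦ A z` of a matrix on Euclidean vectors. -/
def matApply {ι κ : Type*} [Fintype κ] (A : Matrix ι κ ℝ) (z : EuclideanSpace ℝ κ) :
    EuclideanSpace ℝ ι :=
  WithLp.toLp 2 (A *ᵥ WithLp.ofLp z)

/-- `f^A = f ∘ A`. -/
def compMat {ι κ E : Type*} [Fintype κ] (f : EuclideanSpace ℝ ι → E) (A : Matrix ι κ ℝ) :
    EuclideanSpace ℝ κ → E :=
  fun z => f (matApply A z)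

/-- `P_t F^Q = (P_t f_1^{Q_1}, …, P_t f_k^{Q_k})`, a map `ℝ^{kn} → ℝ^k`. -/
def ouVec {k n : ℕ} (t : ℝ) (f : Fin k → EuclideanSpace ℝ (Fin n) → ℝ)
    (Q : Matrix (Fin k × Fin n) (Fin k × Fin n) ℝ)
    (z : EuclideanSpace ℝ (Fin k × Fin n)) : Fin k → ℝ :=
  fun i => ouSemigroup t (compMat (f i) (rowBlock Q i)) z

/-- The stacked vector `((∇P_t f_1)^{Q_1}, …, (∇P_t f_k)^{Q_k})` at the point `z`. -/
def gradVec {k n : ℕ} (t : ℝ) (f : Fin k → EuclideanSpace ℝ (Fin n) → ℝ)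
    (Q : Matrix (Fin k × Fin n) (Fin k × Fin n) ℝ)
    (z : EuclideanSpace ℝ (Fin k × Fin n)) : Fin k × Fin n → ℝ :=
  fun p => compMat (gradient (ouSemigroup t (f p.1))) (rowBlock Q p.1) z p.2

end

open scoped RealInnerProductSpace
open Filter Topology

/-! ### Gaussian measure: integrability, translations, sums and images. -/

section GaussianMeasure

variable {E V : Type*} [NormedAddCommGroup E] [InnerProductSpace ℝ E] [FiniteDimensional ℝ E]
  [MeasurableSpace E] [BorelSpace E]
  [NormedAddCommGroup V] [InnerProductSpace ℝ V] [FiniteDimensional ℝ V]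
  [MeasurableSpace V] [BorelSpace V]

/-! Write `X = QZ` with `Z` standard Gaussian, so `X_i = Q_i Z`; since `m_ii = 1`, each `Q_i` is a
coisometry. Put `F(y) = (f_i(Q_i y))_i` and let `H_r` denote `heat r`. The hypothesis becomes
`H_1(Ψ∘F)(0) = Ψ(H_1 F(0))`, and the Ornstein-Uhlenbeck operator at time `t` is `H_r` with `r = 1 -
e^{-2t} < 1`, evaluated at `e^{-t} x`.

The engine is a short-time expansion (`tendsto_heat_defect_div`): for `U = H_r F`, `h⁻¹ (H_h(Ψ∘U) -
Ψ(H_h U))` tends to `½ E D²Ψ(U)(U'w, U'w)` with `w` Gaussian. As `Q_i w` and `Q_j w` have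
cross-covariance `m_ij I_n`, the limit equals `½ ∑_a v_aᵀ (M ⊙ H_Ψ) v_a`, where `v_a` collects the
`a`-th coordinates of the gradients (`gaussianSecondVariation_rowBlock`). It is nonpositive, so
`H_{1-r}(Ψ∘H_r F)(0)` increases with `r`. This is Jensen's inequality, first for continuous `f_i`
bounded away from `0` and `1`, then by approximation for all measurable ones
(`heat_comp_jointMap_le`).

Equality collapses the chain `H_1(Ψ∘F)(0) = H_{1-r}(H_r(Ψ∘F))(0) ≤ H_{1-r}(Ψ∘H_r F)(0) ≤ Ψ(H_1
F(0))`, so by continuity `H_r(Ψ∘F) = Ψ∘H_r F` everywhere for `0 < r < 1` (`heat_comp_jointMap_eq`).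
Hence the defect of `U = H_r F` vanishes identically for `h < 1 - r`, and so does its limit at each
point whose value is one where `Ψ` is `C²`, boundary values included. A zero of a semidefinite form
lies in its kernel, and applying this to each coordinate `a` gives the identity. -/

theorem integral_cexp_stdGaussian (h t : E) :
    ∫ y, Complex.exp (⟪y, h⟫ + ⟪y, t⟫ * Complex.I) ∂(stdGaussian E)
      = Complex.exp ((‖h‖ ^ 2 - ‖t‖ ^ 2) / 2 + ⟪h, t⟫ * Complex.I) := by
  set b := stdOrthonormalBasis ℝ E
  rw [stdGaussian, integral_map (Measurable.aemeasurable (by fun_prop))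
    (Measurable.aestronglyMeasurable (by fun_prop))]
  have key : ∀ x : Fin (Module.finrank ℝ E) → ℝ,
      Complex.exp ((⟪∑ i, x i • b i, h⟫ : ℝ) + (⟪∑ i, x i • b i, t⟫ : ℝ) * Complex.I)
        = ∏ i, Complex.exp (((⟪b i, h⟫ : ℝ) + (⟪b i, t⟫ : ℝ) * Complex.I) * x i) := by
    intro x
    rw [← Complex.exp_sum]
    congr 1
    simp only [sum_inner, Complex.ofReal_sum, Finset.sum_mul, ← Finset.sum_add_distrib,
      real_inner_smul_left, Complex.ofReal_mul]
    exact Finset.sum_congr rfl fun i _ => by ring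
  rw [integral_congr_ae (.of_forall key)]
  rw [integral_fintype_prod_eq_prod (f := fun i (x : ℝ) ↦
    Complex.exp (((⟪b i, h⟫ : ℝ) + (⟪b i, t⟫ : ℝ) * Complex.I) * x))]
  have h1 : ∀ z : ℂ, ∫ x : ℝ, Complex.exp (z * x) ∂(gaussianReal 0 1)
      = Complex.exp (z ^ 2 / 2) := by
    intro z
    have := complexMGF_id_gaussianReal (μ := 0) (v := 1) z
    simpa [complexMGF] using this
  simp_rw [h1]
  rw [← Complex.exp_sum]
  congr 1
  rw [← Complex.ofReal_pow ‖h‖, ← Complex.ofReal_pow ‖t‖, ← b.sum_sq_inner_right h,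
    ← b.sum_sq_inner_right t, ← b.sum_inner_mul_inner h t]
  push_cast
  rw [← Finset.sum_sub_distrib, Finset.sum_div, Finset.sum_mul, ← Finset.sum_add_distrib]
  refine Finset.sum_congr rfl fun i _ => ?_
  rw [real_inner_comm (b i) h]
  linear_combination (⟪b i, t⟫ : ℂ) ^ 2 / 2 * Complex.I_sq

theorem integrable_norm_stdGaussian : Integrable (fun y : E => ‖y‖) (stdGaussian E) :=
  IsGaussian.integrable_id.norm

theorem integrable_sq_norm_stdGaussian : Integrable (fun y : E => ‖y‖ ^ 2) (stdGaussian E) :=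
  (IsGaussian.memLp_two_id (μ := stdGaussian E)).integrable_norm_pow (by norm_num)

/-- Fernique's theorem, after completing the square: `c‖y‖ ≤ C‖y‖² + c²/(4C)`. -/
theorem integrable_exp_mul_norm_stdGaussian (c : ℝ) :
    Integrable (fun y : E => Real.exp (c * ‖y‖)) (stdGaussian E) := by
  obtain ⟨C, hC, hint⟩ := IsGaussian.exists_integrable_exp_sq (stdGaussian E)
  refine (hint.const_mul (Real.exp (c ^ 2 / (4 * C)))).mono'
    (Measurable.aestronglyMeasurable (by fun_prop)) (.of_forall fun y => ?_)
  rw [Real.norm_eq_abs, abs_of_pos (Real.exp_pos _), ← Real.exp_add]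
  refine Real.exp_le_exp.2 ?_
  have : c ^ 2 / (4 * C) + C * ‖y‖ ^ 2 - c * ‖y‖ = (c - 2 * C * ‖y‖) ^ 2 / (4 * C) := by
    field_simp; ring
  have h2 : 0 ≤ (c - 2 * C * ‖y‖) ^ 2 / (4 * C) := by positivity
  linarith

theorem integrable_exp_inner_stdGaussian (h : E) :
    Integrable (fun y : E => Real.exp (⟪y, h⟫)) (stdGaussian E) := by
  refine (integrable_exp_mul_norm_stdGaussian ‖h‖).mono'
    (Measurable.aestronglyMeasurable (by fun_prop)) (.of_forall fun y => ?_)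
  rw [Real.norm_eq_abs, abs_of_pos (Real.exp_pos _), mul_comm]
  exact Real.exp_le_exp.2 (real_inner_le_norm _ _)

/-- The Cameron-Martin density of the translate of the standard Gaussian measure by `h`. -/
noncomputable def cameronMartinDensity (h y : E) : ℝ := Real.exp (⟪y, h⟫ - ‖h‖ ^ 2 / 2)

theorem continuous_cameronMartinDensity {E : Type*} [NormedAddCommGroup E] [InnerProductSpace ℝ E]
    (h : E) : Continuous (cameronMartinDensity h) := by
  unfold cameronMartinDensity; fun_prop

/-- The characteristic functions agree; the weighted side is the mixed Laplace-Fourier integral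
`integral_cexp_stdGaussian`. -/
theorem stdGaussian_map_add_right (h : E) :
    (stdGaussian E).map (· + h)
      = (stdGaussian E).withDensity (fun y => ENNReal.ofReal (cameronMartinDensity h y)) := by
  have hmeas : Measurable (cameronMartinDensity h) := (continuous_cameronMartinDensity h).measurable
  have hint : Integrable (cameronMartinDensity h) (stdGaussian E) := by
    have := (integrable_exp_inner_stdGaussian h).mul_const (Real.exp (-(‖h‖ ^ 2 / 2)))
    refine this.congr (.of_forall fun y => ?_)
    simp [cameronMartinDensity, sub_eq_add_neg, Real.exp_add]
  have : IsFiniteMeasure ((stdGaussian E).withDensity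
      (fun y => ENNReal.ofReal (cameronMartinDensity h y))) :=
    isFiniteMeasure_withDensity_ofReal hint.2
  have : IsProbabilityMeasure ((stdGaussian E).map (· + h)) :=
    Measure.isProbabilityMeasure_map (by fun_prop)
  apply Measure.ext_of_charFun
  ext t
  rw [charFun_apply, charFun_apply, integral_map (by fun_prop)
    (Measurable.aestronglyMeasurable (by fun_prop)),
    integral_withDensity_eq_integral_toReal_smul (by fun_prop)
      (.of_forall fun _ => ENNReal.ofReal_lt_top)]
  have e1 : ∀ y : E, (ENNReal.ofReal (cameronMartinDensity h y)).toReal •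
      Complex.exp (⟪y, t⟫ * Complex.I) = Complex.exp (-(‖h‖ ^ 2 / 2)) *
      Complex.exp (⟪y, h⟫ + ⟪y, t⟫ * Complex.I) := by
    intro y
    rw [cameronMartinDensity, ENNReal.toReal_ofReal (Real.exp_pos _).le, Complex.real_smul,
      Complex.ofReal_exp, ← Complex.exp_add, ← Complex.exp_add]
    congr 1
    push_cast
    ring
  have e2 : ∀ y : E, Complex.exp ((⟪y + h, t⟫ : ℝ) * Complex.I)
      = Complex.exp (⟪h, t⟫ * Complex.I) * Complex.exp (⟪y, t⟫ * Complex.I) := by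
    intro y
    rw [inner_add_left, ← Complex.exp_add]
    congr 1
    push_cast
    ring
  simp_rw [e1, e2]
  rw [integral_const_mul, integral_const_mul, integral_cexp_stdGaussian, ← charFun_apply,
    charFun_stdGaussian, ← Complex.exp_add, ← Complex.exp_add]
  congr 1
  ring

theorem integral_add_right_stdGaussian {G : Type*} [NormedAddCommGroup G] [NormedSpace ℝ G]
    (f : E → G) (h : E) :
    ∫ y, f (y + h) ∂(stdGaussian E) = ∫ y, cameronMartinDensity h y • f y ∂(stdGaussian E) := by
  have hmeas : Measurable (cameronMartinDensity h) := (continuous_cameronMartinDensity h).measurable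
  have := integral_map_equiv (μ := stdGaussian E) (MeasurableEquiv.addRight h) f
  rw [MeasurableEquiv.coe_addRight] at this
  rw [← this, stdGaussian_map_add_right,
    integral_withDensity_eq_integral_toReal_smul (by fun_prop)
      (.of_forall fun _ => ENNReal.ofReal_lt_top)]
  simp only [ENNReal.toReal_ofReal (Real.exp_pos _).le, cameronMartinDensity]

theorem stdGaussian_prod_map_add {a b : ℝ} (ha : 0 ≤ a) (hb : 0 ≤ b) :
    ((stdGaussian E).prod (stdGaussian E)).map (fun p => √a • p.1 + √b • p.2)
      = (stdGaussian E).map (fun y => √(a + b) • y) := by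
  have : IsProbabilityMeasure (((stdGaussian E).prod (stdGaussian E)).map
      (fun p => √a • p.1 + √b • p.2)) := Measure.isProbabilityMeasure_map (by fun_prop)
  have : IsProbabilityMeasure ((stdGaussian E).map (fun y => √(a + b) • y)) :=
    Measure.isProbabilityMeasure_map (by fun_prop)
  apply Measure.ext_of_charFun
  ext t
  rw [charFun_apply, integral_map (by fun_prop) (Measurable.aestronglyMeasurable (by fun_prop)),
    charFun_map_smul, charFun_stdGaussian]
  have e1 : ∀ p : E × E, Complex.exp ((⟪√a • p.1 + √b • p.2, t⟫ : ℝ) * Complex.I)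
      = Complex.exp ((⟪p.1, √a • t⟫ : ℝ) * Complex.I)
        * Complex.exp ((⟪p.2, √b • t⟫ : ℝ) * Complex.I) := by
    intro p
    rw [← Complex.exp_add]
    congr 1
    simp only [inner_add_left, real_inner_smul_left, real_inner_smul_right]
    push_cast
    ring
  simp_rw [e1]
  rw [integral_prod_mul (fun x : E => Complex.exp ((⟪x, √a • t⟫ : ℝ) * Complex.I))
    (fun x : E => Complex.exp ((⟪x, √b • t⟫ : ℝ) * Complex.I)), ← charFun_apply, ← charFun_apply,
    charFun_stdGaussian, charFun_stdGaussian, ← Complex.exp_add]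
  congr 1
  simp only [norm_smul, Real.norm_eq_abs, mul_pow, Complex.ofReal_mul, ← Complex.ofReal_pow, sq_abs,
    Real.sq_sqrt ha, Real.sq_sqrt hb, Real.sq_sqrt (add_nonneg ha hb)]
  push_cast
  ring

theorem isOpenPosMeasure_stdGaussian : (stdGaussian E).IsOpenPosMeasure := by
  have : (gaussianReal 0 1).IsOpenPosMeasure :=
    (gaussianReal_absolutelyContinuous' 0 one_ne_zero).isOpenPosMeasure
  rw [stdGaussian]
  refine Continuous.isOpenPosMeasure_map (by fun_prop) fun x => ?_
  exact ⟨fun i => ⟪stdOrthonormalBasis ℝ E i, x⟫, (stdOrthonormalBasis ℝ E).sum_repr' x⟩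

/-- The characteristic function of the image at `t` is that of the source at `L* t`, and `‖L* t‖ =
‖t‖` because `L L* = 1`. -/
theorem stdGaussian_map_coisometry (L : E →L[ℝ] V)
    (hL : L ∘L L.adjoint = ContinuousLinearMap.id ℝ V) :
    (stdGaussian E).map L = stdGaussian V := by
  have : IsProbabilityMeasure ((stdGaussian E).map L) :=
    Measure.isProbabilityMeasure_map (by fun_prop)
  apply Measure.ext_of_charFun
  ext t
  rw [charFun_apply, integral_map (by fun_prop) (Measurable.aestronglyMeasurable (by fun_prop))]
  have : ∀ x, ⟪L x, t⟫ = ⟪x, L.adjoint t⟫ := fun x => (L.adjoint_inner_right x t).symm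
  simp_rw [this]
  rw [← charFun_apply, charFun_stdGaussian, charFun_stdGaussian, ← Complex.ofReal_pow,
    ← Complex.ofReal_pow, ← real_inner_self_eq_norm_sq, L.adjoint_inner_left,
    ← ContinuousLinearMap.comp_apply, hL, ContinuousLinearMap.id_apply, real_inner_self_eq_norm_sq]

theorem integral_inner_mul_inner_stdGaussian (u v : E) :
    ∫ y, ⟪u, y⟫ * ⟪v, y⟫ ∂(stdGaussian E) = ⟪u, v⟫ := by
  have h := covarianceBilin_apply_eq_cov (IsGaussian.memLp_two_id (μ := stdGaussian E)) u v
  have hz : ∀ w : E, ∫ y, ⟪w, y⟫ ∂(stdGaussian E) = 0 := fun w => by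
    have := integral_strongDual_stdGaussian (innerSL ℝ w)
    simpa using this
  rw [covarianceBilin_stdGaussian] at h
  rw [covariance] at h
  simp only [hz, sub_zero] at h
  exact h.symm

end GaussianMeasure

/-! ### Differentiating Gaussian integrals through the Cameron-Martin density. -/

section CameronMartinSmooth

variable {E G : Type*} [NormedAddCommGroup E] [InnerProductSpace ℝ E]
  [NormedAddCommGroup G] [NormedSpace ℝ G]

theorem hasFDerivAt_cameronMartinDensity (h y : E) :
    HasFDerivAt (fun h => cameronMartinDensity h y)
      (cameronMartinDensity h y • innerSL ℝ (y - h)) h := by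
  have h1 : HasFDerivAt (fun h : E => ⟪y, h⟫) (innerSL ℝ y) h := (innerSL ℝ y).hasFDerivAt
  have h2 : HasFDerivAt (fun h : E => ‖h‖ ^ 2) (2 • innerSL ℝ h) h :=
    (hasStrictFDerivAt_norm_sq h).hasFDerivAt
  have h3 : HasFDerivAt (fun h : E => ⟪y, h⟫ - ‖h‖ ^ 2 / 2) (innerSL ℝ (y - h)) h := by
    refine ((h1.sub (h2.const_mul (1 / 2))).congr_fderiv ?_).congr_of_eventuallyEq
      (.of_forall fun h => ?_)
    · ext w
      simp
    · simp only [Pi.sub_apply]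
      ring
  exact h3.exp

theorem cameronMartinDensity_pos (h y : E) : 0 < cameronMartinDensity h y := Real.exp_pos _

theorem continuous_cameronMartinDensity_left (y : E) :
    Continuous (fun h => cameronMartinDensity h y) := by
  unfold cameronMartinDensity; fun_prop

theorem cameronMartinDensity_le {R : ℝ} {h : E} (hR : ‖h‖ ≤ R) (y : E) :
    cameronMartinDensity h y ≤ Real.exp (R * ‖y‖) := by
  refine Real.exp_le_exp.2 ?_
  have h1 : ⟪y, h⟫ ≤ ‖y‖ * ‖h‖ := real_inner_le_norm _ _
  have h2 : ‖y‖ * ‖h‖ ≤ R * ‖y‖ := by rw [mul_comm]; gcongr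
  have h3 : 0 ≤ ‖h‖ ^ 2 / 2 := by positivity
  linarith

theorem norm_cameronMartin_fderiv_le {R C : ℝ} {h : E} (hR : ‖h‖ ≤ R) (y : E) {z : G}
    (hz : ‖z‖ ≤ C) :
    ‖cameronMartinDensity h y • (innerSL ℝ (y - h)).smulRight z‖
      ≤ C * Real.exp R * Real.exp ((R + 1) * ‖y‖) := by
  have hC : 0 ≤ C := (norm_nonneg _).trans hz
  rw [norm_smul, ContinuousLinearMap.norm_smulRight_apply, innerSL_apply_norm, Real.norm_eq_abs,
    abs_of_pos (cameronMartinDensity_pos h y)]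
  have h1 := cameronMartinDensity_le hR y
  -- The linear factor is absorbed into an exponential by `s + 1 ≤ exp s`, keeping the dominating
  -- function of the form `exp (c‖y‖)`.
  have h2 : ‖y - h‖ ≤ Real.exp (‖y‖ + R) :=
    (norm_sub_le _ _).trans ((add_le_add_right hR _).trans
      ((le_add_of_nonneg_right zero_le_one).trans (Real.add_one_le_exp _)))
  calc cameronMartinDensity h y * (‖y - h‖ * ‖z‖)
      ≤ Real.exp (R * ‖y‖) * (Real.exp (‖y‖ + R) * C) := by gcongr
    _ = C * Real.exp R * Real.exp ((R + 1) * ‖y‖) := by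
      rw [Real.exp_add, add_mul, one_mul, Real.exp_add]; ring

variable [FiniteDimensional ℝ E] [MeasurableSpace E] [BorelSpace E]

/-- Only the density depends on `h`, so no regularity of `f` is needed. Domination is uniform over
the unit ball around `h`, whence the radius `‖h‖ + 1` in the bound. -/
theorem hasFDerivAt_integral_cameronMartin {f : E → G} (hf : StronglyMeasurable f) {C : ℝ}
    (hC : ∀ x, ‖f x‖ ≤ C) (h : E) :
    HasFDerivAt (𝕜 := ℝ) (fun h : E => ∫ y, cameronMartinDensity h y • f y ∂(stdGaussian E))
      (∫ y, cameronMartinDensity h y • (innerSL ℝ (y - h)).smulRight (f y) ∂(stdGaussian E)) h := by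
  have hCM : ∀ h : E, StronglyMeasurable (cameronMartinDensity h) := fun h =>
    (continuous_cameronMartinDensity h).stronglyMeasurable
  refine hasFDerivAt_integral_of_dominated_of_fderiv_le (𝕜 := ℝ) (s := Metric.ball h 1)
    (F' := fun h y => cameronMartinDensity h y • (innerSL ℝ (y - h)).smulRight (f y))
    (bound := fun y : E => C * Real.exp (‖h‖ + 1) * Real.exp ((‖h‖ + 1 + 1) * ‖y‖))
    (Metric.ball_mem_nhds h one_pos)
    (.of_forall fun h => ((hCM h).smul hf).aestronglyMeasurable) ?_ ?_ ?_ ?_ ?_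
  · refine ((integrable_exp_mul_norm_stdGaussian ‖h‖).mul_const C).mono'
      ((hCM h).smul hf).aestronglyMeasurable (.of_forall fun y => ?_)
    rw [norm_smul, Real.norm_eq_abs, abs_of_pos (cameronMartinDensity_pos h y)]
    exact mul_le_mul (cameronMartinDensity_le le_rfl y) (hC y) (norm_nonneg _) (Real.exp_pos _).le
  · refine ((hCM h).smul ?_).aestronglyMeasurable
    have hc : Continuous fun p : StrongDual ℝ E × G => p.1.smulRight p.2 := by
      fun_prop
    exact hc.comp_stronglyMeasurable
      (((innerSL ℝ).continuous.comp (continuous_id.sub continuous_const)).stronglyMeasurable.prodMk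
        hf)
  · refine .of_forall fun y h' hh' => norm_cameronMartin_fderiv_le ?_ y (hC y)
    have : ‖h' - h‖ < 1 := by simpa [dist_eq_norm] using hh'
    have := norm_le_norm_add_norm_sub h h'
    rw [norm_sub_rev] at this
    linarith
  · exact (integrable_exp_mul_norm_stdGaussian _).const_mul _
  · refine .of_forall fun y h' _ => ?_
    have := (hasFDerivAt_cameronMartinDensity h' y).smul_const (f y)
    convert this using 1
    ext w
    simp [smul_smul]

theorem continuous_integral_cameronMartin_fderiv {f : E → G} (hf : StronglyMeasurable f) {C : ℝ}
    (hC : ∀ x, ‖f x‖ ≤ C) :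
    Continuous (fun h => ∫ y : E, cameronMartinDensity h y • (innerSL ℝ (y - h)).smulRight (f y)
      ∂(stdGaussian E)) := by
  have hc : Continuous fun p : StrongDual ℝ E × G => p.1.smulRight p.2 := by
    fun_prop
  rw [continuous_iff_continuousAt]
  intro h
  refine continuousAt_of_dominated
    (bound := fun y : E => C * Real.exp (‖h‖ + 1) * Real.exp ((‖h‖ + 1 + 1) * ‖y‖))
    (.of_forall fun h => ?_) ?_ ((integrable_exp_mul_norm_stdGaussian _).const_mul _)
    (.of_forall fun y => ?_)
  · refine ((continuous_cameronMartinDensity h).stronglyMeasurable.smul ?_).aestronglyMeasurable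
    exact hc.comp_stronglyMeasurable
      (((innerSL ℝ).continuous.comp (continuous_id.sub continuous_const)).stronglyMeasurable.prodMk
        hf)
  · filter_upwards [Metric.ball_mem_nhds h one_pos] with h' hh'
    refine .of_forall fun y => norm_cameronMartin_fderiv_le ?_ y (hC y)
    have : ‖h' - h‖ < 1 := by simpa [dist_eq_norm] using hh'
    have := norm_le_norm_add_norm_sub h h'
    rw [norm_sub_rev] at this
    linarith
  · refine Continuous.continuousAt ((continuous_cameronMartinDensity_left y).smul ?_)
    exact hc.comp (((innerSL ℝ).continuous.comp (continuous_const.sub continuous_id)).prodMk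
      continuous_const)

theorem norm_integral_cameronMartin_fderiv_zero_le {f : E → G} {C : ℝ}
    (hC : ∀ x, ‖f x‖ ≤ C) :
    ‖∫ y, cameronMartinDensity (0 : E) y • (innerSL ℝ (y - 0)).smulRight (f y) ∂(stdGaussian E)‖
      ≤ C * ∫ y, ‖y‖ ∂(stdGaussian E) := by
  rw [← integral_const_mul]
  refine norm_integral_le_of_norm_le (integrable_norm_stdGaussian.const_mul C)
    (.of_forall fun y => ?_)
  simp only [cameronMartinDensity, inner_zero_right, norm_zero, sub_zero]
  rw [norm_smul, ContinuousLinearMap.norm_smulRight_apply, innerSL_apply_norm]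
  simp only [ne_eq, OfNat.ofNat_ne_zero, not_false_eq_true, zero_pow, zero_div, sub_zero,
    Real.exp_zero, norm_one, one_mul]
  rw [mul_comm]
  gcongr
  exact hC y

end CameronMartinSmooth

/-! ### The heat semigroup and its smoothing property. -/

section Heat

variable {E G : Type*} [NormedAddCommGroup E] [InnerProductSpace ℝ E]
  [FiniteDimensional ℝ E] [MeasurableSpace E] [BorelSpace E]
  [NormedAddCommGroup G] [NormedSpace ℝ G]

/-- The heat semigroup at time `r`: averaging over a Gaussian of variance `r` per coordinate. -/
noncomputable def heat (r : ℝ) (f : E → G) (x : E) : G :=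
  ∫ y, f (x + √r • y) ∂(stdGaussian E)

theorem heat_zero [CompleteSpace G] (f : E → G) : heat 0 f = f := by
  funext x; simp [heat]

theorem norm_heat_le {f : E → G} {C : ℝ} (hC : ∀ x, ‖f x‖ ≤ C) (r : ℝ) (x : E) :
    ‖heat r f x‖ ≤ C := by
  have := norm_integral_le_of_norm_le_const (μ := stdGaussian E)
    (.of_forall fun y => hC (x + √r • y))
  simpa [heat] using this

theorem stronglyMeasurable_heat {f : E → G} (hf : StronglyMeasurable f) (r : ℝ) :
    StronglyMeasurable (heat r f) := by
  have : StronglyMeasurable (fun p : E × E => f (p.1 + √r • p.2)) :=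
    hf.comp_measurable (by fun_prop)
  exact this.integral_prod_right

omit [NormedSpace ℝ G] in
theorem integrable_of_bounded_stdGaussian {f : E → G} (hf : StronglyMeasurable f) {C : ℝ}
    (hC : ∀ x, ‖f x‖ ≤ C) : Integrable f (stdGaussian E) :=
  .of_bound hf.aestronglyMeasurable C (.of_forall hC)

omit [NormedSpace ℝ G] in
theorem integrable_heat_integrand {f : E → G} (hf : StronglyMeasurable f) {C : ℝ}
    (hC : ∀ x, ‖f x‖ ≤ C) (r : ℝ) (x : E) :
    Integrable (fun y => f (x + √r • y)) (stdGaussian E) :=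
  integrable_of_bounded_stdGaussian (hf.comp_measurable (by fun_prop)) fun _ => hC _

theorem heat_mem_of_convex [CompleteSpace G] {f : E → G} (hf : StronglyMeasurable f) {C : ℝ}
    (hC : ∀ x, ‖f x‖ ≤ C) {K : Set G} (hK : Convex ℝ K) (hKc : IsClosed K)
    (hfK : ∀ x, f x ∈ K) (r : ℝ) (x : E) : heat r f x ∈ K :=
  hK.integral_mem hKc (.of_forall fun _ => hfK _) (integrable_heat_integrand hf hC r x)

/-- Fubini, together with the fact that independent centred Gaussians of variances `h` and `r` sum
to one of variance `h + r`. -/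
theorem heat_add {f : E → G} (hf : StronglyMeasurable f) {C : ℝ} (hC : ∀ x, ‖f x‖ ≤ C)
    {h r : ℝ} (hh : 0 ≤ h) (hr : 0 ≤ r) (x : E) :
    heat (h + r) f x = heat h (heat r f) x := by
  have hm : StronglyMeasurable (fun p : E × E => f (x + (√h • p.1 + √r • p.2))) :=
    hf.comp_measurable (by fun_prop)
  have e1 : heat h (heat r f) x
      = ∫ p, f (x + (√h • p.1 + √r • p.2)) ∂((stdGaussian E).prod (stdGaussian E)) := by
    rw [integral_prod _ (.of_bound hm.aestronglyMeasurable C (.of_forall fun p => hC _))]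
    simp only [heat, add_assoc]
  have hm2 : StronglyMeasurable (fun z : E => f (x + z)) := hf.comp_measurable (by fun_prop)
  rw [e1, ← integral_map (φ := fun p : E × E => √h • p.1 + √r • p.2) (f := fun z => f (x + z))
    (by fun_prop) hm2.aestronglyMeasurable, stdGaussian_prod_map_add hh hr,
    integral_map (by fun_prop) hm2.aestronglyMeasurable, heat]

/-- As `x + √r y = √r (y + x/√r)`, translation invariance up to the Cameron-Martin density moves `x`
out of the possibly rough `f` and into a smooth weight. -/
theorem heat_eq_integral_cameronMartin {r : ℝ} (hr : 0 < r) (f : E → G) (x : E) :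
    heat r f x
      = ∫ y, cameronMartinDensity ((√r)⁻¹ • x) y • f (√r • y) ∂(stdGaussian E) := by
  have hr' : √r ≠ 0 := (Real.sqrt_pos.2 hr).ne'
  rw [← integral_add_right_stdGaussian (fun y => f (√r • y)), heat]
  simp only [smul_add, smul_smul, mul_inv_cancel₀ hr', one_smul, add_comm]

theorem contDiff_heat {f : E → G} (hf : StronglyMeasurable f) {C : ℝ} (hC : ∀ x, ‖f x‖ ≤ C)
    {r : ℝ} (hr : 0 < r) : ContDiff ℝ 1 (heat r f) := by
  have hf' : StronglyMeasurable (fun y => f (√r • y)) := hf.comp_measurable (by fun_prop)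
  have h1 : ContDiff ℝ 1
      (fun h => ∫ y, cameronMartinDensity h y • f (√r • y) ∂(stdGaussian E)) :=
    contDiff_one_iff_hasFDerivAt.2
      ⟨_, continuous_integral_cameronMartin_fderiv hf' fun _ => hC _, fun h =>
        hasFDerivAt_integral_cameronMartin hf' (fun _ => hC _) h⟩
  have h2 := h1.comp (contDiff_const_smul (n := 1) (√r)⁻¹ : ContDiff ℝ 1 fun x : E => (√r)⁻¹ • x)
  rwa [show heat r f = _ from funext (heat_eq_integral_cameronMartin hr f)]

omit [BorelSpace E] in
theorem heat_comp_add_left (f : E → G) (r : ℝ) (x y : E) :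
    heat r (fun z => f (x + z)) y = heat r f (x + y) := by
  simp only [heat, add_assoc]

/-- Translating `f` reduces the estimate to the origin, where the density is `1` and its derivative
is the inner product with `y`; the factor `(√r)⁻¹` comes from rescaling. -/
theorem norm_fderiv_heat_le {f : E → G} (hf : StronglyMeasurable f) {C : ℝ} (hC : ∀ x, ‖f x‖ ≤ C)
    {r : ℝ} (hr : 0 < r) (x : E) :
    ‖fderiv ℝ (heat r f) x‖ ≤ C * (∫ y, ‖y‖ ∂(stdGaussian E)) * (√r)⁻¹ := by
  set g : E → G := fun z => f (x + z)
  have hg : StronglyMeasurable (fun y => g (√r • y)) := hf.comp_measurable (by fun_prop)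
  have hgC : ∀ y, ‖g (√r • y)‖ ≤ C := fun _ => hC _
  have e1 : fderiv ℝ (heat r f) x = fderiv ℝ (heat r g) 0 := by
    rw [show heat r g = fun y => heat r f (x + y) from funext (heat_comp_add_left f r x),
      fderiv_comp_add_left, add_zero]
  have e2 := (hasFDerivAt_integral_cameronMartin hg hgC ((√r)⁻¹ • (0 : E))).comp (0 : E)
    ((hasFDerivAt_id (0 : E)).const_smul (√r)⁻¹)
  have e3 : heat r g = (fun h : E => ∫ y, cameronMartinDensity h y • g (√r • y) ∂(stdGaussian E))
      ∘ fun y => (√r)⁻¹ • id y := funext (heat_eq_integral_cameronMartin hr g)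
  have e4 := e2.fderiv
  rw [smul_zero] at e4
  rw [e1, e3]
  refine (congrArg norm e4).trans_le ?_
  refine (ContinuousLinearMap.opNorm_comp_le _ _).trans ?_
  have hC0 : 0 ≤ C := (norm_nonneg _).trans (hC 0)
  have hI : 0 ≤ ∫ y, ‖y‖ ∂(stdGaussian E) := integral_nonneg fun _ => norm_nonneg _
  refine mul_le_mul (norm_integral_cameronMartin_fderiv_zero_le hgC) ?_ (norm_nonneg _)
    (mul_nonneg hC0 hI)
  rw [norm_smul, Real.norm_eq_abs, abs_of_nonneg (by positivity)]
  exact mul_le_of_le_one_right (by positivity) ContinuousLinearMap.norm_id_le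

theorem exists_lipschitz_heat {f : E → G} (hf : StronglyMeasurable f) {C : ℝ}
    (hC : ∀ x, ‖f x‖ ≤ C) {r : ℝ} (hr : 0 < r) :
    ∃ L, 0 ≤ L ∧ ∀ x y, ‖heat r f x - heat r f y‖ ≤ L * ‖x - y‖ := by
  have hC0 : 0 ≤ C := (norm_nonneg _).trans (hC 0)
  have hI : 0 ≤ ∫ y, ‖y‖ ∂(stdGaussian E) := integral_nonneg fun _ => norm_nonneg _
  refine ⟨C * (∫ y, ‖y‖ ∂(stdGaussian E)) * (√r)⁻¹, by positivity, fun x y => ?_⟩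
  exact convex_univ.norm_image_sub_le_of_norm_fderiv_le
    (fun z _ => ((contDiff_heat hf hC hr).differentiable one_ne_zero) z)
    (fun z _ => norm_fderiv_heat_le hf hC hr z) (Set.mem_univ _) (Set.mem_univ _)

end Heat

/-! ### Taylor estimates with derivatives taken within a convex set. -/

section Taylor

variable {X : Type*} [NormedAddCommGroup X] [NormedSpace ℝ X]

/-- The second derivative stays frozen at `p` while both `a` and `b` move, since the base points of
the flow move as `h → 0`. Near `p` the first derivative differs from its linearisation at `p` by a
small Lipschitz error; integrate along the segment from `a` to `b`, which convexity keeps in `K`. -/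
theorem taylor_two_within {Ψ : X → ℝ} {K : Set X} {p : X} (hK : Convex ℝ K)
    (hKu : UniqueDiffOn ℝ K) (hp : p ∈ K) (hΨ : ContDiffWithinAt ℝ 2 Ψ K p) {ε : ℝ} (hε : 0 < ε) :
    ∃ δ > 0, ∀ a ∈ K ∩ Metric.ball p δ, ∀ b ∈ K ∩ Metric.ball p δ,
      |Ψ b - Ψ a - fderivWithin ℝ Ψ K a (b - a)
        - 2⁻¹ * fderivWithin ℝ (fderivWithin ℝ Ψ K) K p (b - a) (b - a)| ≤ ε * ‖b - a‖ ^ 2 := by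
  set D := fderivWithin ℝ Ψ K
  set D2 := fderivWithin ℝ D K
  have hD : ContDiffWithinAt ℝ 1 D K p := hΨ.fderivWithin_right hKu (by norm_num) hp
  have hD2 : ContinuousWithinAt D2 K p :=
    (hD.fderivWithin_right (m := 0) hKu (by norm_num) hp).continuousWithinAt
  have ev1 : ∀ᶠ y in 𝓝[K] p, ContDiffWithinAt ℝ 2 Ψ K y := by
    have := hΨ.eventually (by simp)
    rwa [Set.insert_eq_of_mem hp] at this
  have ev2 : ∀ᶠ y in 𝓝[K] p, ContDiffWithinAt ℝ 1 D K y := by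
    have := hD.eventually (by simp)
    rwa [Set.insert_eq_of_mem hp] at this
  have ev3 : ∀ᶠ y in 𝓝[K] p, ‖D2 y - D2 p‖ ≤ ε := by
    have := hD2.eventually (Metric.closedBall_mem_nhds (D2 p) hε)
    filter_upwards [this] with y hy
    exact (dist_eq_norm (D2 y) (D2 p)).symm.trans_le hy
  obtain ⟨δ, hδ, hball⟩ := Metric.mem_nhdsWithin_iff.1 (ev1.and (ev2.and ev3))
  have hball' : ∀ c ∈ K ∩ Metric.ball p δ, ContDiffWithinAt ℝ 2 Ψ K c ∧
      ContDiffWithinAt ℝ 1 D K c ∧ ‖D2 c - D2 p‖ ≤ ε := fun c hc => hball ⟨hc.2, hc.1⟩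
  have hconv : Convex ℝ (K ∩ Metric.ball p δ) := hK.inter (convex_ball p δ)
  refine ⟨δ, hδ, fun a ha b hb => ?_⟩
  have hDlip : ∀ c ∈ K ∩ Metric.ball p δ, ‖D c - D a - D2 p (c - a)‖ ≤ ε * ‖c - a‖ :=
    fun c hc => hconv.norm_image_sub_le_of_norm_hasFDerivWithin_le' (f' := D2)
      (fun y hy => ((hball' y hy).2.1.differentiableWithinAt one_ne_zero).hasFDerivWithinAt.mono
        Set.inter_subset_left) (fun y hy => (hball' y hy).2.2) ha hc
  set v := b - a
  have hseg : ∀ τ ∈ Set.Icc (0 : ℝ) 1, a + τ • v ∈ K ∩ Metric.ball p δ := fun τ hτ =>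
    hconv.add_smul_sub_mem ha hb hτ
  have hderiv : ∀ τ ∈ Set.Icc (0 : ℝ) 1,
      HasDerivWithinAt (fun τ : ℝ => Ψ (a + τ • v) - τ * D a v - τ ^ 2 / 2 * D2 p v v)
        (D (a + τ • v) v - D a v - τ * D2 p v v) (Set.Icc 0 1) τ := by
    intro τ hτ
    have h1 : HasDerivWithinAt (fun τ : ℝ => a + τ • v) v (Set.Icc 0 1) τ := by
      simpa using ((hasDerivAt_id τ).smul_const v).const_add a |>.hasDerivWithinAt
    have h2 := ((hball' _ (hseg τ hτ)).1.differentiableWithinAt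
      two_ne_zero).hasFDerivWithinAt.comp_hasDerivWithinAt τ h1 (fun σ hσ => (hseg σ hσ).1)
    have h3 : HasDerivWithinAt (fun τ : ℝ => τ * D a v) (D a v) (Set.Icc 0 1) τ := by
      simpa using ((hasDerivAt_id τ).mul_const (D a v)).hasDerivWithinAt
    have h4 : HasDerivWithinAt (fun τ : ℝ => τ ^ 2 / 2 * D2 p v v) (τ * D2 p v v)
        (Set.Icc 0 1) τ := by
      have := (((hasDerivAt_id τ).pow 2).div_const 2).mul_const (D2 p v v)
      refine HasDerivAt.hasDerivWithinAt ?_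
      refine this.congr_deriv ?_
      simp
    exact (h2.sub h3).sub h4
  have hbound : ∀ τ ∈ Set.Ico (0 : ℝ) 1,
      ‖D (a + τ • v) v - D a v - τ * D2 p v v‖ ≤ ε * ‖v‖ ^ 2 := by
    intro τ hτ
    have h := hDlip _ (hseg τ ⟨hτ.1, hτ.2.le⟩)
    rw [add_sub_cancel_left] at h
    have e : D (a + τ • v) v - D a v - τ * D2 p v v
        = (D (a + τ • v) - D a - D2 p (τ • v)) v := by simp
    rw [e]
    refine (ContinuousLinearMap.le_opNorm _ _).trans ?_
    have h5 : ‖τ • v‖ ≤ ‖v‖ := by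
      rw [norm_smul, Real.norm_eq_abs, abs_of_nonneg hτ.1]
      exact mul_le_of_le_one_left (norm_nonneg _) hτ.2.le
    calc _ ≤ ε * ‖τ • v‖ * ‖v‖ := by gcongr
      _ ≤ ε * ‖v‖ * ‖v‖ := by gcongr
      _ = _ := by ring
  have := norm_image_sub_le_of_norm_deriv_le_segment_01' hderiv hbound
  rw [Real.norm_eq_abs] at this
  refine le_of_eq_of_le ?_ this
  congr 1
  simp [v]
  ring

/-- Here `b` ranges over all of `K`, as needed for domination: Gaussian displacements are unbounded.
Near `p` use Taylor; away from it, boundedness of `Ψ` suffices because `‖b - a‖` is bounded below.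
-/
theorem first_order_remainder_le_near {Ψ : X → ℝ} {K : Set X} {p : X} (hK : Convex ℝ K)
    (hKu : UniqueDiffOn ℝ K) (hp : p ∈ K) (hΨ : ContDiffWithinAt ℝ 2 Ψ K p) {C₀ : ℝ}
    (hC₀ : ∀ x ∈ K, |Ψ x| ≤ C₀) :
    ∃ C, 0 ≤ C ∧ ∀ᶠ a in 𝓝[K] p, ∀ b ∈ K,
      |Ψ b - Ψ a - fderivWithin ℝ Ψ K a (b - a)| ≤ C * ‖b - a‖ ^ 2 := by
  obtain ⟨δ, hδ, htaylor⟩ := taylor_two_within hK hKu hp hΨ one_pos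
  set D := fderivWithin ℝ Ψ K
  set B := fderivWithin ℝ D K p
  have hC₀0 : 0 ≤ C₀ := (abs_nonneg _).trans (hC₀ p hp)
  have hDc : ContinuousWithinAt D K p :=
    (hΨ.fderivWithin_right (m := 1) hKu (by norm_num) hp).continuousWithinAt
  have ev : ∀ᶠ a in 𝓝[K] p, ‖D a‖ ≤ ‖D p‖ + 1 := by
    have := hDc.norm.eventually (gt_mem_nhds (lt_add_one ‖D p‖))
    exact this.mono fun a ha => ha.le
  set M := ‖D p‖ + 1
  have hM : 0 ≤ M := by positivity
  -- `1 + ‖B‖` serves `b` in the `δ`-ball. Outside it `‖b - a‖ ≥ δ/2`, so each missing power of `‖b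
  -- - a‖` costs a factor `2/δ`.
  refine ⟨1 + ‖B‖ + (2 * C₀ * (2 / δ) ^ 2 + M * (2 / δ)), by positivity, ?_⟩
  filter_upwards [ev, self_mem_nhdsWithin,
    mem_nhdsWithin_of_mem_nhds (Metric.ball_mem_nhds p (half_pos hδ))] with a haM haK haδ b hb
  have hn : 0 ≤ ‖b - a‖ ^ 2 := by positivity
  by_cases hbδ : b ∈ Metric.ball p δ
  · have h1 := htaylor a ⟨haK, Metric.ball_subset_ball (by linarith) haδ⟩ b ⟨hb, hbδ⟩
    have h2 : |2⁻¹ * B (b - a) (b - a)| ≤ ‖B‖ * ‖b - a‖ ^ 2 := by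
      rw [abs_mul, abs_of_pos (by norm_num : (0 : ℝ) < 2⁻¹)]
      have h3 := B.le_opNorm₂ (b - a) (b - a)
      rw [Real.norm_eq_abs] at h3
      have h4 := abs_nonneg (B (b - a) (b - a))
      nlinarith
    have h3 : |Ψ b - Ψ a - D a (b - a)| ≤ 1 * ‖b - a‖ ^ 2 + ‖B‖ * ‖b - a‖ ^ 2 := by
      have := abs_add_le (Ψ b - Ψ a - D a (b - a) - 2⁻¹ * B (b - a) (b - a))
        (2⁻¹ * B (b - a) (b - a))
      rw [sub_add_cancel] at this
      linarith
    have h4 : 0 ≤ (2 * C₀ * (2 / δ) ^ 2 + M * (2 / δ)) * ‖b - a‖ ^ 2 := by positivity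
    linarith
  · have h1 : δ / 2 ≤ ‖b - a‖ := by
      rw [Metric.mem_ball, not_lt] at hbδ
      rw [Metric.mem_ball] at haδ
      have := dist_triangle b a p
      rw [← dist_eq_norm]
      linarith
    have h2 : 1 ≤ (2 / δ) * ‖b - a‖ := by
      calc 1 = (2 / δ) * (δ / 2) := by field_simp
        _ ≤ _ := by gcongr
    have h3 : |Ψ b - Ψ a - D a (b - a)| ≤ 2 * C₀ + M * ‖b - a‖ := by
      have e1 := abs_sub (Ψ b - Ψ a) (D a (b - a))
      have e2 := abs_sub (Ψ b) (Ψ a)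
      have e3 := hC₀ a haK
      have e4 := hC₀ b hb
      have e5 : |D a (b - a)| ≤ M * ‖b - a‖ := (D a).le_of_opNorm_le haM _
      linarith
    have h4 : 2 * C₀ ≤ 2 * C₀ * ((2 / δ) * ‖b - a‖) ^ 2 :=
      le_mul_of_one_le_right (by positivity) (one_le_pow₀ h2)
    have h5 : M * ‖b - a‖ ≤ M * ‖b - a‖ * ((2 / δ) * ‖b - a‖) :=
      le_mul_of_one_le_right (by positivity) h2
    have h6 : 0 ≤ (1 + ‖B‖) * ‖b - a‖ ^ 2 := by positivity
    calc _ ≤ 2 * C₀ * ((2 / δ) * ‖b - a‖) ^ 2 + M * ‖b - a‖ * ((2 / δ) * ‖b - a‖)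
          + (1 + ‖B‖) * ‖b - a‖ ^ 2 := by linarith
      _ = _ := by ring

theorem first_order_remainder_le_of_isCompact {Ψ : X → ℝ} {K S : Set X} (hK : Convex ℝ K)
    (hKu : UniqueDiffOn ℝ K) (hS : IsCompact S) (hSK : S ⊆ K)
    (hΨ : ∀ p ∈ S, ContDiffWithinAt ℝ 2 Ψ K p) {C₀ : ℝ} (hC₀ : ∀ x ∈ K, |Ψ x| ≤ C₀) :
    ∃ C, 0 ≤ C ∧ ∀ a ∈ S, ∀ b ∈ K,
      |Ψ b - Ψ a - fderivWithin ℝ Ψ K a (b - a)| ≤ C * ‖b - a‖ ^ 2 := by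
  refine hS.induction_on (p := fun S => ∃ C, 0 ≤ C ∧ ∀ a ∈ S, ∀ b ∈ K,
      |Ψ b - Ψ a - fderivWithin ℝ Ψ K a (b - a)| ≤ C * ‖b - a‖ ^ 2) ⟨0, le_rfl, by simp⟩
    (fun s t hst ⟨C, h0, hC⟩ => ⟨C, h0, fun a ha => hC a (hst ha)⟩) ?_ ?_
  · rintro s t ⟨C, h0, hC⟩ ⟨C', h0', hC'⟩
    refine ⟨max C C', h0.trans (le_max_left _ _), fun a ha b hb => ?_⟩
    rcases ha with ha | ha
    · exact (hC a ha b hb).trans (by gcongr; exact le_max_left _ _)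
    · exact (hC' a ha b hb).trans (by gcongr; exact le_max_right _ _)
  · intro p hp
    obtain ⟨C, h0, hC⟩ := first_order_remainder_le_near hK hKu (hSK hp) (hΨ p hp) hC₀
    exact ⟨_, nhdsWithin_mono p hSK hC, C, h0, fun a ha => ha⟩

end Taylor

/-! ### Short-time expansion of the Jensen defect. -/

section LocalExpansion

variable {E X : Type*} [NormedAddCommGroup E] [InnerProductSpace ℝ E]
  [FiniteDimensional ℝ E] [MeasurableSpace E] [BorelSpace E]
  [NormedAddCommGroup X] [NormedSpace ℝ X]

theorem norm_sub_heat_le [CompleteSpace X] {U : E → X} (hU : Continuous U) {CU : ℝ}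
    (hCU : ∀ x, ‖U x‖ ≤ CU) {L : ℝ} (hL0 : 0 ≤ L) (hL : ∀ x y, ‖U x - U y‖ ≤ L * ‖x - y‖) (h : ℝ)
    (z w : E) :
    ‖U (z + √h • w) - heat h U z‖ ≤ L * √h * (‖w‖ + ∫ y : E, ‖y‖ ∂(stdGaussian E)) := by
  have hi := integrable_heat_integrand hU.stronglyMeasurable hCU h z
  have e : U (z + √h • w) - heat h U z
      = ∫ y, (U (z + √h • w) - U (z + √h • y)) ∂(stdGaussian E) := by
    rw [integral_sub (integrable_const _) hi]
    simp [heat]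
  have hb : Integrable (fun y : E => L * √h * (‖w‖ + ‖y‖)) (stdGaussian E) :=
    ((integrable_const _).add integrable_norm_stdGaussian).const_mul _
  rw [e]
  refine (norm_integral_le_of_norm_le hb (.of_forall fun y => ?_)).trans_eq ?_
  · refine (hL _ _).trans ?_
    rw [add_sub_add_left_eq_sub, ← smul_sub, norm_smul, Real.norm_eq_abs,
      abs_of_nonneg (Real.sqrt_nonneg h), mul_assoc]
    gcongr
    exact norm_sub_le _ _
  · rw [integral_const_mul, integral_add (integrable_const _) integrable_norm_stdGaussian]
    simp

/-- `U(z + √h w) - heat h U z` has mean zero in `w`, so any linear functional of it may be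
subtracted; `D` is later the derivative of `Ψ` at `heat h U z`. -/
theorem heat_comp_sub_eq_integral_remainder [CompleteSpace X] {Ψ : X → ℝ} (hΨ : Continuous Ψ)
    {C₀ : ℝ} {U : E → X} (hC₀ : ∀ x, |Ψ (U x)| ≤ C₀) (hU : Continuous U) {CU : ℝ}
    (hCU : ∀ x, ‖U x‖ ≤ CU) (h : ℝ) (z : E) (D : X →L[ℝ] ℝ) :
    heat h (Ψ ∘ U) z - Ψ (heat h U z)
      = ∫ w, (Ψ (U (z + √h • w)) - Ψ (heat h U z) - D (U (z + √h • w) - heat h U z))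
        ∂(stdGaussian E) := by
  have hi := integrable_heat_integrand hU.stronglyMeasurable hCU h z
  have hi2 : Integrable (fun w => Ψ (U (z + √h • w))) (stdGaussian E) :=
    integrable_heat_integrand (hΨ.comp hU).stronglyMeasurable (C := C₀) (fun x => hC₀ x) h z
  have hi3 : Integrable (fun w => U (z + √h • w) - heat h U z) (stdGaussian E) :=
    hi.sub (integrable_const _)
  have hi4 : Integrable (fun w => Ψ (U (z + √h • w)) - Ψ (heat h U z)) (stdGaussian E) :=
    hi2.sub (integrable_const _)
  rw [integral_sub hi4 (D.integrable_comp hi3), integral_sub hi2 (integrable_const _),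
    D.integral_comp_comm hi3, integral_sub hi (integrable_const _)]
  simp [heat]

theorem integrable_norm_add_sq_stdGaussian (m : ℝ) :
    Integrable (fun w : E => (‖w‖ + m) ^ 2) (stdGaussian E) := by
  have : (fun w : E => (‖w‖ + m) ^ 2) = fun w => ‖w‖ ^ 2 + 2 * m * ‖w‖ + m ^ 2 := by
    funext w; ring
  rw [this]
  exact (integrable_sq_norm_stdGaussian.add (integrable_norm_stdGaussian.const_mul _)).add
    (integrable_const _)

theorem abs_heat_comp_sub_le [CompleteSpace X] {Ψ : X → ℝ} (hΨ : Continuous Ψ) {C₀ : ℝ}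
    {U : E → X} (hC₀ : ∀ x, |Ψ (U x)| ≤ C₀) (hU : Continuous U) {CU : ℝ} (hCU : ∀ x, ‖U x‖ ≤ CU)
    {L : ℝ} (hL0 : 0 ≤ L) (hL : ∀ x y, ‖U x - U y‖ ≤ L * ‖x - y‖) {h : ℝ} (hh : 0 ≤ h) (z : E)
    (D : X →L[ℝ] ℝ) {C : ℝ} (hC0 : 0 ≤ C)
    (hC : ∀ x, |Ψ (U x) - Ψ (heat h U z) - D (U x - heat h U z)| ≤ C * ‖U x - heat h U z‖ ^ 2) :
    |heat h (Ψ ∘ U) z - Ψ (heat h U z)|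
      ≤ C * L ^ 2 * (∫ w : E, (‖w‖ + ∫ y : E, ‖y‖ ∂(stdGaussian E)) ^ 2 ∂(stdGaussian E)) * h := by
  rw [heat_comp_sub_eq_integral_remainder hΨ hC₀ hU hCU h z D, ← Real.norm_eq_abs]
  refine (norm_integral_le_of_norm_le
    ((integrable_norm_add_sq_stdGaussian (∫ y : E, ‖y‖ ∂(stdGaussian E))).const_mul (C * L ^ 2 * h))
    (.of_forall fun w => ?_)).trans_eq ?_
  · rw [Real.norm_eq_abs]
    refine (hC _).trans ?_
    have h1 := norm_sub_heat_le hU hCU hL0 hL h z w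
    calc C * ‖U (z + √h • w) - heat h U z‖ ^ 2
        ≤ C * (L * √h * (‖w‖ + ∫ y : E, ‖y‖ ∂(stdGaussian E))) ^ 2 := by gcongr
      _ = _ := by rw [mul_pow, mul_pow, Real.sq_sqrt hh]; ring
  · rw [integral_const_mul]; ring

omit [FiniteDimensional ℝ E] [MeasurableSpace E] [BorelSpace E] in
-- Strict differentiability is what allows the base point `z n` to move with `n`.
theorem tendsto_difference_quotient_of_strict {U : E → X} {U' : E →L[ℝ] X} {x : E}
    (hU : HasStrictFDerivAt U U' x) {α : Type*} {l : Filter α} {h : α → ℝ} {z : α → E}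
    (hh : Tendsto h l (𝓝[>] 0)) (hz : Tendsto z l (𝓝 x)) (w : E) :
    Tendsto (fun n => (√(h n))⁻¹ • (U (z n + √(h n) • w) - U (z n))) l (𝓝 (U' w)) := by
  have hh0 : Tendsto (fun n => √(h n)) l (𝓝 0) := by
    have := (Real.continuous_sqrt.tendsto 0).comp (tendsto_nhds_of_tendsto_nhdsWithin hh)
    simpa [Function.comp_def] using this
  have hpos : ∀ᶠ n in l, 0 < √(h n) :=
    (hh.eventually self_mem_nhdsWithin).mono fun n hn => Real.sqrt_pos.2 hn
  have hz2 : Tendsto (fun n => z n + √(h n) • w) l (𝓝 x) := by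
    simpa using hz.add (hh0.smul_const w)
  have h1 := hU.isLittleO.comp_tendsto (hz2.prodMk_nhds hz)
  have h2 : (fun n => √(h n) • w) =O[l] fun n => √(h n) := by
    refine Asymptotics.IsBigO.of_bound ‖w‖ (.of_forall fun n => ?_)
    rw [norm_smul, mul_comm]
  have h3 : (fun n => U (z n + √(h n) • w) - U (z n) - √(h n) • U' w) =o[l] fun n => √(h n) := by
    refine Asymptotics.IsLittleO.trans_isBigO ?_ h2
    simpa [Function.comp_def] using h1
  have h4 := h3.norm_left.norm_right.tendsto_div_nhds_zero
  rw [tendsto_iff_norm_sub_tendsto_zero]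
  refine h4.congr' ?_
  filter_upwards [hpos] with n hn
  have : (√(h n))⁻¹ • (U (z n + √(h n) • w) - U (z n)) - U' w
      = (√(h n))⁻¹ • (U (z n + √(h n) • w) - U (z n) - √(h n) • U' w) := by
    rw [smul_sub (√(h n))⁻¹ _ (√(h n) • U' w), smul_smul, inv_mul_cancel₀ hn.ne', one_smul]
  rw [this, norm_smul, norm_inv, div_eq_inv_mul]

theorem tendsto_heat_of_lipschitz [CompleteSpace X] {U : E → X} (hU : Continuous U) {CU : ℝ}
    (hCU : ∀ x, ‖U x‖ ≤ CU) {L : ℝ} (hL0 : 0 ≤ L) (hL : ∀ x y, ‖U x - U y‖ ≤ L * ‖x - y‖)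
    {x : E} {α : Type*} {l : Filter α} {h : α → ℝ} {z : α → E}
    (hh : Tendsto h l (𝓝[>] 0)) (hz : Tendsto z l (𝓝 x)) :
    Tendsto (fun n => heat (h n) U (z n)) l (𝓝 (U x)) := by
  have hh0 : Tendsto (fun n => √(h n)) l (𝓝 0) := by
    have := (Real.continuous_sqrt.tendsto 0).comp (tendsto_nhds_of_tendsto_nhdsWithin hh)
    simpa [Function.comp_def] using this
  have h1 : Tendsto (fun n => U (z n) - heat (h n) U (z n)) l (𝓝 0) := by
    have h2 : Tendsto (fun n => L * √(h n) * (‖(0 : E)‖ + ∫ y : E, ‖y‖ ∂(stdGaussian E))) l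
        (𝓝 0) := by
      simpa using (hh0.const_mul L).mul_const (‖(0 : E)‖ + ∫ y : E, ‖y‖ ∂(stdGaussian E))
    refine squeeze_zero_norm (fun n => ?_) h2
    simpa using norm_sub_heat_le hU hCU hL0 hL (h n) (z n) 0
  simpa using ((hU.tendsto x).comp hz).sub h1

/-- The short time expansion of the defect `P_h (Ψ ∘ U) - Ψ (P_h U)` in Jensen's inequality. -/
theorem tendsto_heat_defect_div [CompleteSpace X] {Ψ : X → ℝ} (hΨ : Continuous Ψ) {K : Set X}
    (hK : Convex ℝ K) (hKu : UniqueDiffOn ℝ K) (hKc : IsClosed K) {C₀ : ℝ}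
    (hC₀ : ∀ x ∈ K, |Ψ x| ≤ C₀)
    {U : E → X} (hUK : ∀ x, U x ∈ K) {CU : ℝ} (hCU : ∀ x, ‖U x‖ ≤ CU) {L : ℝ} (hL0 : 0 ≤ L)
    (hL : ∀ x y, ‖U x - U y‖ ≤ L * ‖x - y‖) {U' : E →L[ℝ] X} {x : E}
    (hU' : HasStrictFDerivAt U U' x) (hΨ2 : ContDiffWithinAt ℝ 2 Ψ K (U x))
    {α : Type*} {l : Filter α} [l.IsCountablyGenerated] {h : α → ℝ} {z : α → E}
    (hh : Tendsto h l (𝓝[>] 0)) (hz : Tendsto z l (𝓝 x)) :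
    Tendsto (fun n => (h n)⁻¹ * (heat (h n) (Ψ ∘ U) (z n) - Ψ (heat (h n) U (z n)))) l
      (𝓝 (∫ w, 2⁻¹ * fderivWithin ℝ (fderivWithin ℝ Ψ K) K (U x) (U' w) (U' w)
        ∂(stdGaussian E))) := by
  have hU : Continuous U := (LipschitzWith.of_dist_le_mul (K := ⟨L, hL0⟩) fun x y => by
    rw [dist_eq_norm, dist_eq_norm]; exact hL x y).continuous
  set p := U x
  set D := fderivWithin ℝ Ψ K
  set B := fderivWithin ℝ D K p
  set a : α → X := fun n => heat (h n) U (z n)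
  have haK : ∀ n, a n ∈ K := fun n =>
    heat_mem_of_convex hU.stronglyMeasurable hCU hK hKc hUK (h n) (z n)
  have hap : Tendsto a l (𝓝 p) := tendsto_heat_of_lipschitz hU hCU hL0 hL hh hz
  have hapK : Tendsto a l (𝓝[K] p) := tendsto_nhdsWithin_iff.2 ⟨hap, .of_forall haK⟩
  have hh0 : Tendsto (fun n => √(h n)) l (𝓝 0) := by
    have := (Real.continuous_sqrt.tendsto 0).comp (tendsto_nhds_of_tendsto_nhdsWithin hh)
    simpa [Function.comp_def] using this
  have hpos : ∀ᶠ n in l, 0 < h n := hh.eventually self_mem_nhdsWithin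
  set m := ∫ y : E, ‖y‖ ∂(stdGaussian E)
  set d : E → α → X := fun w n => (√(h n))⁻¹ • (U (z n + √(h n) • w) - a n)
  have hdbound : ∀ w, ∀ᶠ n in l, ‖d w n‖ ≤ L * (‖w‖ + m) := by
    intro w
    filter_upwards [hpos] with n hn
    have h1 := norm_sub_heat_le hU hCU hL0 hL (h n) (z n) w
    have h2 : 0 < √(h n) := Real.sqrt_pos.2 hn
    rw [norm_smul, norm_inv, Real.norm_eq_abs, abs_of_pos h2, inv_mul_le_iff₀ h2]
    linarith
  -- The drift of the mean is `o(√h)`: the limit of the quotient is the Gaussian mean of the linear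
  -- map `U'`, which is zero. Hence replacing `U (z n)` by `a n` does not change the limiting
  -- increments.
  have hq0 : Tendsto (fun n => (√(h n))⁻¹ • (a n - U (z n))) l (𝓝 0) := by
    have h1 : Tendsto (fun n => ∫ w, (√(h n))⁻¹ • (U (z n + √(h n) • w) - U (z n))
        ∂(stdGaussian E)) l (𝓝 (∫ w, U' w ∂(stdGaussian E))) := by
      refine tendsto_integral_filter_of_dominated_convergence (fun w => L * ‖w‖)
        (.of_forall fun n => ?_) ?_ (integrable_norm_stdGaussian.const_mul L)
        (.of_forall fun w => tendsto_difference_quotient_of_strict hU' hh hz w)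
      · exact Continuous.aestronglyMeasurable (by fun_prop)
      · filter_upwards [hpos] with n hn
        refine .of_forall fun w => ?_
        have h2 : 0 < √(h n) := Real.sqrt_pos.2 hn
        have h3 := hL (z n + √(h n) • w) (z n)
        rw [add_sub_cancel_left, norm_smul, Real.norm_eq_abs, abs_of_pos h2] at h3
        rw [norm_smul, norm_inv, Real.norm_eq_abs, abs_of_pos h2, inv_mul_le_iff₀ h2]
        linarith
    have h2 : ∫ w, U' w ∂(stdGaussian E) = 0 := by
      have := U'.integral_comp_comm (IsGaussian.integrable_id (μ := stdGaussian E))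
      simpa using this
    rw [h2] at h1
    refine h1.congr fun n => ?_
    rw [integral_smul, integral_sub
      (integrable_heat_integrand hU.stronglyMeasurable hCU (h n) (z n)) (integrable_const _)]
    simp [a, heat]
  have hdlim : ∀ w, Tendsto (d w) l (𝓝 (U' w)) := by
    intro w
    have := (tendsto_difference_quotient_of_strict hU' hh hz w).sub hq0
    rw [sub_zero] at this
    refine this.congr fun n => ?_
    rw [← smul_sub, sub_sub_sub_cancel_right]
  obtain ⟨C, hC0, hC⟩ := first_order_remainder_le_near hK hKu (hUK x) hΨ2 hC₀
  set R : E → α → ℝ := fun w n =>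
    Ψ (U (z n + √(h n) • w)) - Ψ (a n) - D (a n) (U (z n + √(h n) • w) - a n)
  have hscale : ∀ᶠ n in l, ∀ w, (h n)⁻¹ * ‖U (z n + √(h n) • w) - a n‖ ^ 2 = ‖d w n‖ ^ 2 := by
    filter_upwards [hpos] with n hn w
    rw [norm_smul, norm_inv, Real.norm_eq_abs, abs_of_pos (Real.sqrt_pos.2 hn), mul_pow, inv_pow,
      Real.sq_sqrt hn.le]
  have hlim : ∀ w, Tendsto (fun n => (h n)⁻¹ * R w n) l (𝓝 (2⁻¹ * B (U' w) (U' w))) := by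
    intro w
    have hB : Tendsto (fun n => 2⁻¹ * B (d w n) (d w n)) l (𝓝 (2⁻¹ * B (U' w) (U' w))) := by
      have hc : Continuous fun v : X => 2⁻¹ * B v v := by fun_prop
      exact (hc.tendsto _).comp (hdlim w)
    have hzero : Tendsto (fun n => (h n)⁻¹ * R w n - 2⁻¹ * B (d w n) (d w n)) l (𝓝 0) := by
      rw [Metric.tendsto_nhds]
      intro ε hε
      -- `N` bounds the squared rescaled increment; the `+ 1` makes it positive, so that Taylor
      -- accuracy `ε / N / 2` yields a final error at most `ε / 2`.
      set N := (L * (‖w‖ + m)) ^ 2 + 1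
      have hN : 0 < N := by positivity
      obtain ⟨δ, hδ, htaylor⟩ := taylor_two_within hK hKu (hUK x) hΨ2 (half_pos (div_pos hε hN))
      have hz2 : Tendsto (fun n => U (z n + √(h n) • w)) l (𝓝 p) := by
        have : Tendsto (fun n => z n + √(h n) • w) l (𝓝 x) := by
          simpa using hz.add (hh0.smul_const w)
        exact (hU.tendsto x).comp this
      filter_upwards [hpos, hap (Metric.ball_mem_nhds p hδ), hz2 (Metric.ball_mem_nhds p hδ),
        hdbound w, hscale] with n hn ha hb hd hs
      have h1 := htaylor (a n) ⟨haK n, ha⟩ _ ⟨hUK _, hb⟩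
      have h2 : (h n)⁻¹ * R w n - 2⁻¹ * B (d w n) (d w n)
          = (h n)⁻¹ * (R w n - 2⁻¹ * B (U (z n + √(h n) • w) - a n)
            (U (z n + √(h n) • w) - a n)) := by
        have h4 : (√(h n))⁻¹ * (√(h n))⁻¹ = (h n)⁻¹ := by
          rw [← mul_inv, Real.mul_self_sqrt hn.le]
        simp only [d, map_smul, smul_apply, smul_eq_mul]
        rw [mul_sub, ← h4]
        ring
      rw [dist_zero_right, h2, Real.norm_eq_abs, abs_mul, abs_of_pos (inv_pos.2 hn)]
      calc _ ≤ (h n)⁻¹ * (ε / N / 2 * ‖U (z n + √(h n) • w) - a n‖ ^ 2) := by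
            gcongr
        _ = ε / N / 2 * ‖d w n‖ ^ 2 := by rw [← hs w]; ring
        _ ≤ ε / N / 2 * (L * (‖w‖ + m)) ^ 2 := by gcongr
        _ ≤ ε / N / 2 * N := by gcongr; simp [N]
        _ < ε := by field_simp; linarith
    simpa using hzero.add hB
  have hmain : Tendsto (fun n => ∫ w, (h n)⁻¹ * R w n ∂(stdGaussian E)) l
      (𝓝 (∫ w, 2⁻¹ * B (U' w) (U' w) ∂(stdGaussian E))) := by
    refine tendsto_integral_filter_of_dominated_convergence (fun w => C * L ^ 2 * (‖w‖ + m) ^ 2)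
      (.of_forall fun n => ?_) ?_ ((integrable_norm_add_sq_stdGaussian m).const_mul _)
      (.of_forall hlim)
    · exact Continuous.aestronglyMeasurable (by fun_prop)
    · filter_upwards [hpos, hapK.eventually hC, hscale] with n hn hCn hs
      refine .of_forall fun w => ?_
      have h2 : ‖d w n‖ ≤ L * (‖w‖ + m) := by
        have h1 := norm_sub_heat_le hU hCU hL0 hL (h n) (z n) w
        have h2 : 0 < √(h n) := Real.sqrt_pos.2 hn
        rw [norm_smul, norm_inv, Real.norm_eq_abs, abs_of_pos h2, inv_mul_le_iff₀ h2]
        linarith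
      rw [Real.norm_eq_abs, abs_mul, abs_of_pos (inv_pos.2 hn)]
      calc _ ≤ (h n)⁻¹ * (C * ‖U (z n + √(h n) • w) - a n‖ ^ 2) := by
            gcongr; exact hCn _ (hUK _)
        _ = C * ‖d w n‖ ^ 2 := by rw [← hs w]; ring
        _ ≤ C * (L * (‖w‖ + m)) ^ 2 := by gcongr
        _ = _ := by ring
  refine hmain.congr fun n => ?_
  rw [integral_const_mul, heat_comp_sub_eq_integral_remainder hΨ (fun x => hC₀ _ (hUK x)) hU hCU
    (h n) (z n) (D (a n))]

end LocalExpansion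

/-! ### Monotone interpolation along the heat flow. -/

section JensenInequality

variable {E X : Type*} [NormedAddCommGroup E] [InnerProductSpace ℝ E]
  [FiniteDimensional ℝ E] [MeasurableSpace E] [BorelSpace E]
  [NormedAddCommGroup X] [NormedSpace ℝ X]

theorem continuous_heat_uncurry {F : E → X} (hF : Continuous F) {C : ℝ} (hC : ∀ x, ‖F x‖ ≤ C) :
    Continuous fun p : ℝ × E => heat p.1 F p.2 := by
  unfold heat
  refine continuous_of_dominated (bound := fun _ => C) (fun p => ?_)
    (fun p => .of_forall fun y => hC _)
    (integrable_const _) (.of_forall fun y => ?_)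
  · exact Continuous.aestronglyMeasurable (by fun_prop)
  · fun_prop

theorem hasStrictFDerivAt_heat [CompleteSpace X] {f : E → X} (hf : StronglyMeasurable f) {C : ℝ}
    (hC : ∀ x, ‖f x‖ ≤ C) {r : ℝ} (hr : 0 < r) (x : E) :
    HasStrictFDerivAt (heat r f) (fderiv ℝ (heat r f) x) x :=
  (contDiff_heat hf hC hr).contDiffAt.hasStrictFDerivAt one_ne_zero

/-- Jensen's inequality for the heat semigroup and a continuous `F`, under the infinitesimal
concavity condition along the flow. -/
theorem heat_comp_le_of_infinitesimal [CompleteSpace X] {Ψ : X → ℝ} (hΨ : Continuous Ψ)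
    {K S : Set X} (hK : Convex ℝ K) (hKu : UniqueDiffOn ℝ K) (hKc : IsClosed K) {C₀ : ℝ}
    (hC₀ : ∀ x ∈ K, |Ψ x| ≤ C₀) (hS : IsCompact S) (hSconv : Convex ℝ S) (hSK : S ⊆ K)
    (hΨ2 : ∀ p ∈ S, ContDiffWithinAt ℝ 2 Ψ K p)
    {F : E → X} (hF : Continuous F) (hFS : ∀ x, F x ∈ S)
    (hneg : ∀ r, 0 < r → ∀ x, ∫ w, 2⁻¹ * fderivWithin ℝ (fderivWithin ℝ Ψ K) K (heat r F x)
      (fderiv ℝ (heat r F) x w) (fderiv ℝ (heat r F) x w) ∂(stdGaussian E) ≤ 0) :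
    heat 1 (Ψ ∘ F) 0 ≤ Ψ (heat 1 F 0) := by
  obtain ⟨CF, hCF'⟩ := hS.isBounded.exists_norm_le
  have hCF : ∀ x, ‖F x‖ ≤ CF := fun x => hCF' _ (hFS x)
  have hFm : StronglyMeasurable F := hF.stronglyMeasurable
  have hheatS : ∀ r x, heat r F x ∈ S := fun r x =>
    heat_mem_of_convex hFm hCF hSconv hS.isClosed hFS r x
  have hheatC : ∀ r x, ‖heat r F x‖ ≤ CF := fun r x => norm_heat_le hCF r x
  have hheat_cont : Continuous fun p : ℝ × E => heat p.1 F p.2 := continuous_heat_uncurry hF hCF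
  have hUcont : ∀ r, Continuous (heat r F) := fun r =>
    hheat_cont.comp (continuous_const.prodMk continuous_id)
  -- The interpolation runs from `heat 1 (Ψ ∘ F) 0` at `r = 0` to `Ψ (heat 1 F 0)` at `r = 1`.
  set φ : ℝ → ℝ := fun r => heat (1 - r) (Ψ ∘ heat r F) 0
  have hφ : Continuous φ := by
    refine continuous_of_dominated (bound := fun _ => C₀) (fun r => ?_)
      (fun r => .of_forall fun y => hC₀ _ (hSK (hheatS _ _))) (integrable_const _)
      (.of_forall fun y => ?_)
    · have := hUcont r
      exact Continuous.aestronglyMeasurable (by fun_prop)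
    · exact hΨ.comp (hheat_cont.comp (continuous_id.prodMk (by fun_prop)))
  -- Compactness of `S` makes the remainder constant independent of the base point, which dominates
  -- the outer Gaussian integral below.
  obtain ⟨C, hC0, hC⟩ := first_order_remainder_le_of_isCompact hK hKu hS hSK hΨ2 hC₀
  have hstep : ∀ r ∈ Set.Ioo (0 : ℝ) 1, ∃ ℓ ≤ 0, Tendsto (slope (-φ) r) (𝓝[>] r) (𝓝 ℓ) := by
    intro r hr
    set U := heat r F
    obtain ⟨L, hL0, hL⟩ := exists_lipschitz_heat hFm hCF hr.1
    have hΨU : StronglyMeasurable (Ψ ∘ U) := (hΨ.comp (hUcont r)).stronglyMeasurable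
    have hΨUC : ∀ x, ‖(Ψ ∘ U) x‖ ≤ C₀ := fun x => hC₀ _ (hSK (hheatS r x))
    set q : ℝ → E → ℝ := fun s w => (s - r)⁻¹ * (heat (s - r) (Ψ ∘ U) (√(1 - s) • w)
      - Ψ (heat (s - r) U (√(1 - s) • w)))
    have hev : ∀ᶠ s in 𝓝[>] r, s ∈ Set.Ioo r 1 := Ioo_mem_nhdsGT hr.2
    -- By the semigroup law, both `φ r` and `φ s` are averages at time `1 - s`, and their difference
    -- is the average of the Jensen defect of `U` over the time step `s - r`.
    have hslope : ∀ᶠ s in 𝓝[>] r, ∫ w, q s w ∂(stdGaussian E) = slope (-φ) r s := by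
      filter_upwards [hev] with s hs
      have e1 : φ r = ∫ w, heat (s - r) (Ψ ∘ U) (√(1 - s) • w) ∂(stdGaussian E) := by
        have := heat_add hΨU hΨUC (h := 1 - s) (r := s - r) (by linarith [hs.2])
          (by linarith [hs.1]) (0 : E)
        rw [sub_add_sub_cancel] at this
        simp only [φ, U] at this ⊢
        rw [this]
        simp only [heat, zero_add]
      have e2 : φ s = ∫ w, Ψ (heat (s - r) U (√(1 - s) • w)) ∂(stdGaussian E) := by
        have : heat s F = heat (s - r) U := by
          funext x
          rw [← heat_add hFm hCF (by linarith [hs.1]) hr.1.le, sub_add_cancel]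
        simp only [φ]
        rw [this]
        simp only [heat, zero_add, Function.comp]
      have i1 : Integrable (fun w => heat (s - r) (Ψ ∘ U) (√(1 - s) • w)) (stdGaussian E) :=
        integrable_of_bounded_stdGaussian
          ((stronglyMeasurable_heat hΨU _).comp_measurable (by fun_prop))
          fun w => norm_heat_le hΨUC _ _
      have i2 : Integrable (fun w => Ψ (heat (s - r) U (√(1 - s) • w))) (stdGaussian E) := by
        refine integrable_of_bounded_stdGaussian (C := C₀)
          (hΨ.comp_stronglyMeasurable ((stronglyMeasurable_heat
            (hUcont r).stronglyMeasurable _).comp_measurable (by fun_prop))) fun w => ?_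
        exact hC₀ _ (hSK (heat_mem_of_convex (hUcont r).stronglyMeasurable (hheatC r) hSconv
          hS.isClosed (hheatS r) _ _))
      simp only [q]
      rw [integral_const_mul, integral_sub i1 i2, ← e1, ← e2, slope_def_field]
      simp only [Pi.neg_apply]
      rw [div_eq_inv_mul]
      ring
    refine ⟨∫ v, ∫ w, 2⁻¹ * fderivWithin ℝ (fderivWithin ℝ Ψ K) K (U (√(1 - r) • v))
      (fderiv ℝ U (√(1 - r) • v) w) (fderiv ℝ U (√(1 - r) • v) w) ∂(stdGaussian E)
      ∂(stdGaussian E), integral_nonpos fun v => hneg r hr.1 _, ?_⟩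
    refine Tendsto.congr' hslope ?_
    have hsub : Tendsto (fun s => s - r) (𝓝[>] r) (𝓝[>] 0) := by
      refine tendsto_nhdsWithin_iff.2 ⟨?_, ?_⟩
      · have : Tendsto (fun s : ℝ => s - r) (𝓝 r) (𝓝 (r - r)) := tendsto_id.sub_const r
        rw [sub_self] at this
        exact this.mono_left nhdsWithin_le_nhds
      · filter_upwards [hev] with s hs
        exact sub_pos.2 hs.1
    refine tendsto_integral_filter_of_dominated_convergence
      (fun _ => C * L ^ 2 *
        ∫ w : E, (‖w‖ + ∫ y : E, ‖y‖ ∂(stdGaussian E)) ^ 2 ∂(stdGaussian E))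
      (.of_forall fun s => ?_) ?_ (integrable_const _) (.of_forall fun v => ?_)
    · refine StronglyMeasurable.aestronglyMeasurable ?_
      refine StronglyMeasurable.const_mul (StronglyMeasurable.sub ?_ ?_) _
      · exact (stronglyMeasurable_heat hΨU _).comp_measurable (by fun_prop)
      · exact hΨ.comp_stronglyMeasurable ((stronglyMeasurable_heat
            (hUcont r).stronglyMeasurable _).comp_measurable (by fun_prop))
    · filter_upwards [hev] with s hs
      refine .of_forall fun w => ?_
      have hsr : 0 < s - r := sub_pos.2 hs.1
      have haS : heat (s - r) U (√(1 - s) • w) ∈ S :=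
        heat_mem_of_convex (hUcont r).stronglyMeasurable (hheatC r) hSconv hS.isClosed
          (hheatS r) _ _
      have := abs_heat_comp_sub_le hΨ hΨUC (hUcont r) (hheatC r) hL0 hL hsr.le (√(1 - s) • w)
        (fderivWithin ℝ Ψ K (heat (s - r) U (√(1 - s) • w))) hC0
        (fun x => hC _ haS _ (hSK (hheatS r x)))
      simp only [q]
      rw [norm_mul, norm_inv, Real.norm_eq_abs, abs_of_pos hsr, Real.norm_eq_abs,
        inv_mul_le_iff₀ hsr, mul_comm (s - r)]
      exact this
    · have hz : Tendsto (fun s => √(1 - s) • v) (𝓝[>] r) (𝓝 (√(1 - r) • v)) := by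
        have : Continuous fun s : ℝ => √(1 - s) • v := by fun_prop
        exact (this.tendsto r).mono_left nhdsWithin_le_nhds
      exact tendsto_heat_defect_div hΨ hK hKu hKc hC₀ (fun x => hSK (hheatS r x)) (hheatC r) hL0 hL
        (hasStrictFDerivAt_heat hFm hCF hr.1 _) (hΨ2 _ (hheatS r _)) hsub hz
  -- Starting at `δ > 0` is necessary because `F` is only continuous and smoothing acts for `r > 0`;
  -- continuity of `φ` then reaches `0`. Right slopes of `-φ` suffice for monotonicity.
  have hmono : ∀ δ ∈ Set.Ioo (0 : ℝ) 1, φ δ ≤ φ 1 := by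
    intro δ hδ
    have := image_le_of_liminf_slope_right_le_deriv_boundary (f := -φ) (a := δ) (b := 1)
      hφ.neg.continuousOn (B := fun _ => -φ δ) (B' := fun _ => 0) le_rfl continuousOn_const
      (fun x _ => hasDerivWithinAt_const _ _ _) (fun x hx ρ hρ => ?_)
      (Set.right_mem_Icc.2 hδ.2.le)
    · simpa using this
    · obtain ⟨ℓ, hℓ, hlim⟩ := hstep x ⟨hδ.1.trans_le hx.1, hx.2⟩
      exact (hlim.eventually (gt_mem_nhds (hℓ.trans_lt hρ))).frequently
  have h0 : φ 0 ≤ φ 1 := by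
    have hlim : Tendsto φ (𝓝[>] 0) (𝓝 (φ 0)) := (hφ.tendsto 0).mono_left nhdsWithin_le_nhds
    refine le_of_tendsto hlim ?_
    filter_upwards [Ioo_mem_nhdsGT one_pos] with δ hδ using hmono δ hδ
  simpa [φ, heat_zero] using h0

end JensenInequality

/-! ### Geometry of the cube. -/

section UnitCube

variable {k : ℕ}

theorem unitCube_eq_Icc : unitCube k = Set.Icc 0 1 := by
  ext x; simp [unitCube, Pi.le_def, forall_and]

theorem convex_unitCube : Convex ℝ (unitCube k) := by
  rw [unitCube_eq_Icc]; exact convex_Icc _ _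

theorem isClosed_unitCube : IsClosed (unitCube k) := by
  rw [unitCube_eq_Icc]; exact isClosed_Icc

theorem interior_unitCube : interior (unitCube k) = openUnitCube k := by
  rw [unitCube_eq_Icc, ← Set.pi_univ_Icc, interior_pi_set Set.finite_univ]
  ext x
  simp [openUnitCube]

theorem isOpen_openUnitCube : IsOpen (openUnitCube k) := by
  rw [← interior_unitCube]; exact isOpen_interior

theorem openUnitCube_subset_unitCube : openUnitCube k ⊆ unitCube k := by
  rw [← interior_unitCube]; exact interior_subset

theorem openUnitCube_nonempty : (openUnitCube k).Nonempty :=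
  ⟨fun _ => 2⁻¹, fun _ => by norm_num⟩

theorem uniqueDiffOn_unitCube : UniqueDiffOn ℝ (unitCube k) :=
  uniqueDiffOn_convex convex_unitCube (by rw [interior_unitCube]; exact openUnitCube_nonempty)

theorem norm_le_one_of_mem_unitCube {x : Fin k → ℝ} (hx : x ∈ unitCube k) : ‖x‖ ≤ 1 := by
  rw [pi_norm_le_iff_of_nonneg zero_le_one]
  intro i
  rw [Real.norm_eq_abs, abs_of_nonneg (hx i).1]
  exact (hx i).2

theorem contDiffWithinAt_unitCube {Ψ : (Fin k → ℝ) → ℝ}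
    (hΨ : ContDiffOn ℝ 2 Ψ (openUnitCube k)) {p : Fin k → ℝ} (hp : p ∈ openUnitCube k) :
    ContDiffWithinAt ℝ 2 Ψ (unitCube k) p :=
  ((hΨ p hp).contDiffAt (isOpen_openUnitCube.mem_nhds hp)).contDiffWithinAt

end UnitCube

/-! ### Jensen's inequality and its equality case for joint maps. -/

section JointMaps

variable {E V : Type*} [NormedAddCommGroup E] [InnerProductSpace ℝ E] [FiniteDimensional ℝ E]
  [MeasurableSpace E] [BorelSpace E]
  [NormedAddCommGroup V] [InnerProductSpace ℝ V] [FiniteDimensional ℝ V]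
  [MeasurableSpace V] [BorelSpace V] {k : ℕ}

/-- The map `y ↦ (f₁ (L₁ y), …, f_k (L_k y))`. -/
def jointMap (L : Fin k → E →L[ℝ] V) (f : Fin k → V → ℝ) (y : E) : Fin k → ℝ :=
  fun i => f i (L i y)

omit [FiniteDimensional ℝ E] [FiniteDimensional ℝ V] in
theorem stronglyMeasurable_jointMap (L : Fin k → E →L[ℝ] V) {f : Fin k → V → ℝ}
    (hf : ∀ i, Measurable (f i)) : StronglyMeasurable (jointMap L f) := by
  refine Measurable.stronglyMeasurable (measurable_pi_lambda _ fun i => ?_)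
  exact (hf i).comp (L i).continuous.measurable

omit [FiniteDimensional ℝ E] [MeasurableSpace E] [BorelSpace E] [FiniteDimensional ℝ V]
  [MeasurableSpace V] [BorelSpace V] in
theorem jointMap_mem_unitCube (L : Fin k → E →L[ℝ] V) {f : Fin k → V → ℝ}
    (hf01 : ∀ i x, f i x ∈ Set.Icc (0 : ℝ) 1) (y : E) : jointMap L f y ∈ unitCube k :=
  fun i => hf01 i _

omit [FiniteDimensional ℝ E] [MeasurableSpace E] [BorelSpace E] [FiniteDimensional ℝ V]
  [MeasurableSpace V] [BorelSpace V] in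
theorem norm_jointMap_le (L : Fin k → E →L[ℝ] V) {f : Fin k → V → ℝ}
    (hf01 : ∀ i x, f i x ∈ Set.Icc (0 : ℝ) 1) (y : E) : ‖jointMap L f y‖ ≤ 1 :=
  norm_le_one_of_mem_unitCube (jointMap_mem_unitCube L hf01 y)

theorem heat_comp_coisometry {L : E →L[ℝ] V}
    (hL : L ∘L L.adjoint = ContinuousLinearMap.id ℝ V) {g : V → ℝ} (hg : Measurable g) (r : ℝ)
    (x : E) : heat r (fun y => g (L y)) x = heat r g (L x) := by
  simp only [heat, map_add, map_smul]
  rw [← stdGaussian_map_coisometry L hL, integral_map (by fun_prop)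
    (Measurable.aestronglyMeasurable (by fun_prop))]

theorem heat_jointMap {L : Fin k → E →L[ℝ] V}
    (hL : ∀ i, L i ∘L (L i).adjoint = ContinuousLinearMap.id ℝ V) {f : Fin k → V → ℝ}
    (hf : ∀ i, Measurable (f i)) (hf01 : ∀ i x, f i x ∈ Set.Icc (0 : ℝ) 1) (r : ℝ) :
    heat r (jointMap L f) = jointMap L (fun i => heat r (f i)) := by
  funext x i
  rw [heat, eval_integral]
  · exact heat_comp_coisometry (hL i) (hf i) r x
  · intro i
    refine integrable_of_bounded_stdGaussian (C := 1) (Measurable.stronglyMeasurable ?_) fun y => ?_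
    · exact (hf i).comp (by fun_prop)
    · exact (norm_le_pi_norm (jointMap L f (x + √r • y)) i).trans (norm_jointMap_le L hf01 _)

theorem norm_le_one_of_mem_Icc {a : ℝ} (ha : a ∈ Set.Icc (0 : ℝ) 1) : ‖a‖ ≤ 1 := by
  rw [Real.norm_eq_abs, abs_of_nonneg ha.1]; exact ha.2

theorem heat_mem_Icc {g : V → ℝ} (hg : Measurable g) {a b : ℝ}
    (hgab : ∀ x, g x ∈ Set.Icc a b) (r : ℝ) (x : V) : heat r g x ∈ Set.Icc a b :=
  heat_mem_of_convex hg.stronglyMeasurable (C := max |a| |b|)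
    (fun x => abs_le_max_abs_abs (hgab x).1 (hgab x).2) (convex_Icc a b)
    isClosed_Icc hgab r x

theorem fderiv_heat_jointMap {L : Fin k → E →L[ℝ] V}
    (hL : ∀ i, L i ∘L (L i).adjoint = ContinuousLinearMap.id ℝ V) {f : Fin k → V → ℝ}
    (hf : ∀ i, Measurable (f i)) (hf01 : ∀ i x, f i x ∈ Set.Icc (0 : ℝ) 1) {r : ℝ} (hr : 0 < r)
    (x y : E) :
    fderiv ℝ (heat r (jointMap L f)) x y
      = fun i => ⟪gradient (heat r (f i)) (L i x), L i y⟫ := by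
  have h1 : ∀ i, HasFDerivAt (fun x => heat r (f i) (L i x))
      ((fderiv ℝ (heat r (f i)) (L i x)) ∘L (L i)) x := fun i =>
    (((contDiff_heat (hf i).stronglyMeasurable (fun x => norm_le_one_of_mem_Icc (hf01 i x))
      hr).differentiable one_ne_zero) (L i x)).hasFDerivAt.comp x (L i).hasFDerivAt
  have h2 := hasFDerivAt_pi.2 h1
  rw [heat_jointMap hL hf hf01]
  unfold jointMap
  rw [h2.fderiv]
  funext i
  simp [inner_gradient_left]

/-- The expected second variation of `Ψ` along Gaussian directions `(⟪w_i, L_i y⟫)_i` at `p`. -/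
noncomputable def gaussianSecondVariation (L : Fin k → E →L[ℝ] V) (Ψ : (Fin k → ℝ) → ℝ)
    (p : Fin k → ℝ) (w : Fin k → V) : ℝ :=
  ∫ y, 2⁻¹ * fderivWithin ℝ (fderivWithin ℝ Ψ (unitCube k)) (unitCube k) p
    (fun i => ⟪w i, L i y⟫) (fun i => ⟪w i, L i y⟫) ∂(stdGaussian E)

/-- Averaging keeps the flow in the compact subcube `[a,b]^k` of the open cube, so no information on
the derivatives of `Ψ` at the boundary is used. -/
theorem heat_comp_jointMap_le_of_continuous_of_interior {L : Fin k → E →L[ℝ] V}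
    (hL : ∀ i, L i ∘L (L i).adjoint = ContinuousLinearMap.id ℝ V) {Ψ : (Fin k → ℝ) → ℝ}
    (hΨ : Continuous Ψ) {C₀ : ℝ} (hC₀ : ∀ x, |Ψ x| ≤ C₀)
    (hΨ2 : ContDiffOn ℝ 2 Ψ (openUnitCube k))
    (hneg : ∀ p ∈ openUnitCube k, ∀ w, gaussianSecondVariation L Ψ p w ≤ 0)
    {f : Fin k → V → ℝ} (hf : ∀ i, Continuous (f i)) {a b : ℝ} (ha : 0 < a) (hb : b < 1)
    (hfab : ∀ i x, f i x ∈ Set.Icc a b) :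
    heat 1 (Ψ ∘ jointMap L f) 0 ≤ Ψ (heat 1 (jointMap L f) 0) := by
  set S : Set (Fin k → ℝ) := Set.Icc (fun _ => a) (fun _ => b)
  have hSo : S ⊆ openUnitCube k := fun x hx i => ⟨ha.trans_le (hx.1 i), (hx.2 i).trans_lt hb⟩
  have hf01 : ∀ i x, f i x ∈ Set.Icc (0 : ℝ) 1 := fun i x =>
    ⟨ha.le.trans (hfab i x).1, (hfab i x).2.trans hb.le⟩
  have hfm : ∀ i, Measurable (f i) := fun i => (hf i).measurable
  refine heat_comp_le_of_infinitesimal hΨ convex_unitCube uniqueDiffOn_unitCube isClosed_unitCube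
    (fun x _ => hC₀ x) (S := S) isCompact_Icc (convex_Icc _ _)
    (hSo.trans openUnitCube_subset_unitCube)
    (fun p hp => contDiffWithinAt_unitCube hΨ2 (hSo hp)) ?_ (fun x => ?_) fun r hr x => ?_
  · exact continuous_pi fun i => (hf i).comp (L i).continuous
  · exact ⟨fun i => (hfab i _).1, fun i => (hfab i _).2⟩
  · simp_rw [fderiv_heat_jointMap hL hfm hf01 hr]
    refine hneg _ ?_ _
    rw [heat_jointMap hL hfm hf01]
    refine fun i => ?_
    have := heat_mem_Icc (hfm i) (hfab i) r (L i x)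
    exact ⟨ha.trans_le this.1, this.2.trans_lt hb⟩

omit [FiniteDimensional ℝ V] in
theorem heat_comp_jointMap_le_of_tendsto {L : Fin k → E →L[ℝ] V} {Ψ : (Fin k → ℝ) → ℝ}
    (hΨ : Continuous Ψ) {C₀ : ℝ} (hC₀ : ∀ x, |Ψ x| ≤ C₀) {g : ℕ → Fin k → V → ℝ}
    (hg : ∀ n i, Measurable (g n i)) (hg01 : ∀ n i x, g n i x ∈ Set.Icc (0 : ℝ) 1)
    {f : Fin k → V → ℝ}
    (hlim : ∀ i, ∀ᵐ y ∂(stdGaussian E), Tendsto (fun n => g n i (L i y)) atTop (𝓝 (f i (L i y))))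
    (hle : ∀ᶠ n in atTop,
      heat 1 (Ψ ∘ jointMap L (g n)) 0 ≤ Ψ (heat 1 (jointMap L (g n)) 0)) :
    heat 1 (Ψ ∘ jointMap L f) 0 ≤ Ψ (heat 1 (jointMap L f) 0) := by
  have hlim' : ∀ᵐ y ∂(stdGaussian E),
      Tendsto (fun n => jointMap L (g n) y) atTop (𝓝 (jointMap L f y)) := by
    filter_upwards [ae_all_iff.2 hlim] with y hy
    exact tendsto_pi_nhds.2 hy
  have h1 : Tendsto (fun n => heat 1 (jointMap L (g n)) 0) atTop (𝓝 (heat 1 (jointMap L f) 0)) := by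
    simp only [heat, Real.sqrt_one, one_smul, zero_add]
    exact tendsto_integral_of_dominated_convergence (fun _ => 1)
      (fun n => (stronglyMeasurable_jointMap L (hg n)).aestronglyMeasurable) (integrable_const _)
      (fun n => .of_forall fun y => norm_jointMap_le L (hg01 n) y) hlim'
  have h2 : Tendsto (fun n => heat 1 (Ψ ∘ jointMap L (g n)) 0) atTop
      (𝓝 (heat 1 (Ψ ∘ jointMap L f) 0)) := by
    simp only [heat, Real.sqrt_one, one_smul, zero_add]
    refine tendsto_integral_of_dominated_convergence (fun _ => C₀)
      (fun n => (hΨ.comp_stronglyMeasurable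
        (stronglyMeasurable_jointMap L (hg n))).aestronglyMeasurable) (integrable_const _)
      (fun n => .of_forall fun y => hC₀ _) ?_
    filter_upwards [hlim'] with y hy
    exact (hΨ.tendsto _).comp hy
  exact le_of_tendsto_of_tendsto h2 ((hΨ.tendsto _).comp h1) hle

theorem heat_comp_jointMap_le_of_continuous {L : Fin k → E →L[ℝ] V}
    (hL : ∀ i, L i ∘L (L i).adjoint = ContinuousLinearMap.id ℝ V) {Ψ : (Fin k → ℝ) → ℝ}
    (hΨ : Continuous Ψ) {C₀ : ℝ} (hC₀ : ∀ x, |Ψ x| ≤ C₀)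
    (hΨ2 : ContDiffOn ℝ 2 Ψ (openUnitCube k))
    (hneg : ∀ p ∈ openUnitCube k, ∀ w, gaussianSecondVariation L Ψ p w ≤ 0)
    {f : Fin k → V → ℝ} (hf : ∀ i, Continuous (f i))
    (hf01 : ∀ i x, f i x ∈ Set.Icc (0 : ℝ) 1) :
    heat 1 (Ψ ∘ jointMap L f) 0 ≤ Ψ (heat 1 (jointMap L f) 0) := by
  -- The affine map `s ↦ (1 - 2ε) s + ε` carries `[0,1]` into `[ε, 1 - ε]`; `ε ≤ 1/4` keeps its
  -- slope positive.
  set ε : ℕ → ℝ := fun n => 1 / ((n : ℝ) + 1) / 4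
  have hε0 : ∀ n, 0 < ε n := fun n => by positivity
  have hε1 : ∀ n, ε n ≤ 1 / 4 := fun n => by
    have : 1 / ((n : ℝ) + 1) ≤ 1 := by
      rw [div_le_one (by positivity)]; linarith [(Nat.cast_nonneg n : (0 : ℝ) ≤ n)]
    simp only [ε]; linarith
  have hεlim : Tendsto ε atTop (𝓝 0) := by
    simpa [ε] using (tendsto_one_div_add_atTop_nhds_zero_nat (𝕜 := ℝ)).div_const 4
  have hmem : ∀ n i x, (1 - 2 * ε n) * f i x + ε n ∈ Set.Icc (ε n) (1 - ε n) := fun n i x => by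
    have h1 := (hf01 i x).1
    have h2 := (hf01 i x).2
    have h3 := hε1 n
    constructor <;> nlinarith
  have hcont : ∀ n i, Continuous fun x => (1 - 2 * ε n) * f i x + ε n := fun n i =>
    (continuous_const.mul (hf i)).add continuous_const
  refine heat_comp_jointMap_le_of_tendsto hΨ hC₀
    (g := fun n i x => (1 - 2 * ε n) * f i x + ε n) (fun n i => (hcont n i).measurable)
    (fun n i x => ?_) (fun i => .of_forall fun y => ?_) (.of_forall fun n => ?_)
  · have := hmem n i x
    have h3 := hε0 n
    exact ⟨h3.le.trans this.1, this.2.trans (by linarith)⟩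
  · have := ((hεlim.const_mul 2).const_sub 1).mul_const (f i (L i y)) |>.add hεlim
    simpa using this
  · exact heat_comp_jointMap_le_of_continuous_of_interior hL hΨ hC₀ hΨ2 hneg (hcont n) (hε0 n)
      (sub_lt_self 1 (hε0 n)) (hmem n)

/-- A measurable `[0,1]`-valued function is an a.e. limit of continuous ones. -/
theorem exists_continuous_tendsto_ae {g : V → ℝ} (hg : Measurable g)
    (hg01 : ∀ x, g x ∈ Set.Icc (0 : ℝ) 1) (μ : Measure V) [IsFiniteMeasure μ] :
    ∃ u : ℕ → V → ℝ, (∀ n, Continuous (u n)) ∧ (∀ n x, u n x ∈ Set.Icc (0 : ℝ) 1) ∧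
      ∀ᵐ x ∂μ, Tendsto (fun n => u n x) atTop (𝓝 (g x)) := by
  have hmem : MemLp g 1 μ := MemLp.of_bound hg.aestronglyMeasurable 1
    (.of_forall fun x => norm_le_one_of_mem_Icc (hg01 x))
  have hex : ∀ n : ℕ, ∃ v : BoundedContinuousFunction V ℝ,
      eLpNorm (g - ⇑v) 1 μ ≤ ((n : ENNReal) + 1)⁻¹ ∧ MemLp (⇑v) 1 μ := fun n =>
    hmem.exists_boundedContinuous_eLpNorm_sub_le ENNReal.one_ne_top (by simp)
  choose v hv hv' using hex
  have hlim : Tendsto (fun n => eLpNorm (⇑(v n) - g) 1 μ) atTop (𝓝 0) := by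
    refine tendsto_of_tendsto_of_tendsto_of_le_of_le tendsto_const_nhds
      (h := fun n : ℕ => ((n : ENNReal) + 1)⁻¹) ?_ (fun _ => zero_le) fun n => ?_
    · have := (tendsto_add_atTop_iff_nat 1).2 ENNReal.tendsto_inv_nat_nhds_zero
      simpa using this
    · rw [eLpNorm_sub_comm]; exact hv n
  obtain ⟨ns, -, hns⟩ := (tendstoInMeasure_of_tendsto_eLpNorm one_ne_zero
    (fun n => (v n).continuous.aestronglyMeasurable) hg.aestronglyMeasurable
    hlim).exists_seq_tendsto_ae
  -- Clamping to `[0,1]` preserves the a.e. limit, since it fixes the values of `g`.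
  have hclamp : Continuous fun a : ℝ => max 0 (min 1 a) := by fun_prop
  refine ⟨fun n x => max 0 (min 1 (v (ns n) x)), fun n => hclamp.comp (v (ns n)).continuous,
    fun n x => ⟨le_max_left _ _, max_le zero_le_one (min_le_left _ _)⟩, ?_⟩
  filter_upwards [hns] with x hx
  have := (hclamp.tendsto (g x)).comp hx
  rwa [min_eq_right (hg01 x).2, max_eq_right (hg01 x).1] at this

/-- Jensen's inequality `E Ψ(f_1(L_1 Z), …) ≤ Ψ(E f_1(L_1 Z), …)` for measurable functions. -/
theorem heat_comp_jointMap_le {L : Fin k → E →L[ℝ] V}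
    (hL : ∀ i, L i ∘L (L i).adjoint = ContinuousLinearMap.id ℝ V) {Ψ : (Fin k → ℝ) → ℝ}
    (hΨ : Continuous Ψ) {C₀ : ℝ} (hC₀ : ∀ x, |Ψ x| ≤ C₀)
    (hΨ2 : ContDiffOn ℝ 2 Ψ (openUnitCube k))
    (hneg : ∀ p ∈ openUnitCube k, ∀ w, gaussianSecondVariation L Ψ p w ≤ 0)
    {f : Fin k → V → ℝ} (hf : ∀ i, Measurable (f i))
    (hf01 : ∀ i x, f i x ∈ Set.Icc (0 : ℝ) 1) (r : ℝ) (x : E) :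
    heat r (Ψ ∘ jointMap L f) x ≤ Ψ (heat r (jointMap L f) x) := by
  -- Absorbing the translation and dilation into the functions reduces general `r` and `x` to time
  -- `1` at the origin.
  set f' : Fin k → V → ℝ := fun i v => f i (L i x + √r • v)
  have hf' : ∀ i, Measurable (f' i) := fun i => (hf i).comp (by fun_prop)
  have hf'01 : ∀ i x, f' i x ∈ Set.Icc (0 : ℝ) 1 := fun i x => hf01 i _
  have e : ∀ y, jointMap L f (x + √r • y) = jointMap L f' (0 + √1 • y) := fun y => by
    funext i; simp [jointMap, f']
  suffices h : heat 1 (Ψ ∘ jointMap L f') 0 ≤ Ψ (heat 1 (jointMap L f') 0) by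
    simpa only [heat, Function.comp, e] using h
  choose u hu hu01 hulim using fun i =>
    exists_continuous_tendsto_ae (hf' i) (hf'01 i) (stdGaussian V)
  refine heat_comp_jointMap_le_of_tendsto hΨ hC₀ (g := fun n i => u i n)
    (fun n i => (hu i n).measurable) (fun n i => hu01 i n) (fun i => ?_) (.of_forall fun n => ?_)
  -- Almost everywhere convergence on `V` pulls back along `L i` because `L i` maps one standard
  -- Gaussian to the other.
  · have := hulim i
    rw [← stdGaussian_map_coisometry (L i) (hL i)] at this
    exact ae_of_ae_map (by fun_prop) this
  · exact heat_comp_jointMap_le_of_continuous hL hΨ hC₀ hΨ2 hneg (fun i => hu i n)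
      (fun i => hu01 i n)

/-- If equality holds in Jensen's inequality at time `1`, it holds at all earlier times. -/
theorem heat_comp_jointMap_eq {L : Fin k → E →L[ℝ] V}
    (hL : ∀ i, L i ∘L (L i).adjoint = ContinuousLinearMap.id ℝ V) {Ψ : (Fin k → ℝ) → ℝ}
    (hΨ : Continuous Ψ) {C₀ : ℝ} (hC₀ : ∀ x, |Ψ x| ≤ C₀)
    (hΨ2 : ContDiffOn ℝ 2 Ψ (openUnitCube k))
    (hneg : ∀ p ∈ openUnitCube k, ∀ w, gaussianSecondVariation L Ψ p w ≤ 0)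
    {f : Fin k → V → ℝ} (hf : ∀ i, Measurable (f i))
    (hf01 : ∀ i x, f i x ∈ Set.Icc (0 : ℝ) 1)
    (heq : heat 1 (Ψ ∘ jointMap L f) 0 = Ψ (heat 1 (jointMap L f) 0))
    {r : ℝ} (hr0 : 0 < r) (hr1 : r < 1) (x : E) :
    heat r (Ψ ∘ jointMap L f) x = Ψ (heat r (jointMap L f) x) := by
  have hF := stronglyMeasurable_jointMap L hf
  have hFC := norm_jointMap_le L hf01
  have hΨF : StronglyMeasurable (Ψ ∘ jointMap L f) := hΨ.comp_stronglyMeasurable hF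
  have hΨFC : ∀ x, ‖(Ψ ∘ jointMap L f) x‖ ≤ C₀ := fun x => hC₀ _
  have c1 : Continuous (heat r (Ψ ∘ jointMap L f)) := (contDiff_heat hΨF hΨFC hr0).continuous
  have c2 : Continuous (fun x => Ψ (heat r (jointMap L f) x)) :=
    hΨ.comp (contDiff_heat hF hFC hr0).continuous
  set s := √(1 - r)
  have hs : s ≠ 0 := (Real.sqrt_pos.2 (sub_pos.2 hr1)).ne'
  have hle : ∀ x, heat r (Ψ ∘ jointMap L f) x ≤ Ψ (heat r (jointMap L f) x) :=
    heat_comp_jointMap_le hL hΨ hC₀ hΨ2 hneg hf hf01 r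
  have e1 : heat 1 (Ψ ∘ jointMap L f) 0
      = ∫ y, heat r (Ψ ∘ jointMap L f) (s • y) ∂(stdGaussian E) := by
    rw [← sub_add_cancel 1 r, heat_add hΨF hΨFC (sub_nonneg.2 hr1.le) hr0.le, heat]
    simp [s]
  -- Jensen is applied a second time, to the functions `heat r (f i)` over the remaining time `1 -
  -- r`. With `e1` and `heq`, this squeezes the integral of the nonnegative defect to zero.
  have e2 : ∫ y, Ψ (heat r (jointMap L f) (s • y)) ∂(stdGaussian E)
      ≤ Ψ (heat 1 (jointMap L f) 0) := by
    have := heat_comp_jointMap_le hL hΨ hC₀ hΨ2 hneg (f := fun i => heat r (f i))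
      (fun i => (stronglyMeasurable_heat (hf i).stronglyMeasurable r).measurable)
      (fun i => heat_mem_Icc (hf i) (hf01 i) r) (1 - r) 0
    rw [← heat_jointMap hL hf hf01, ← heat_add hF hFC (sub_nonneg.2 hr1.le) hr0.le,
      sub_add_cancel] at this
    refine le_of_eq_of_le ?_ this
    rw [heat]
    simp [s]
  have i1 : Integrable (fun y => heat r (Ψ ∘ jointMap L f) (s • y)) (stdGaussian E) :=
    integrable_of_bounded_stdGaussian (Continuous.stronglyMeasurable (by fun_prop))
      fun y => norm_heat_le hΨFC r _
  have i2 : Integrable (fun y => Ψ (heat r (jointMap L f) (s • y))) (stdGaussian E) :=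
    integrable_of_bounded_stdGaussian (Continuous.stronglyMeasurable
      (c2.comp (continuous_const_smul s))) fun y => hC₀ _
  have h0 : ∫ y, (Ψ (heat r (jointMap L f) (s • y)) - heat r (Ψ ∘ jointMap L f) (s • y))
      ∂(stdGaussian E) = 0 := by
    refine le_antisymm ?_ (integral_nonneg fun y => sub_nonneg.2 (hle _))
    rw [integral_sub i2 i1, ← e1, heq]
    exact sub_nonpos.2 e2
  rw [integral_eq_zero_iff_of_nonneg (fun y => sub_nonneg.2 (hle _)) (i2.sub i1)] at h0
  -- Full support upgrades almost everywhere equality of continuous functions to equality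
  -- everywhere.
  have := isOpenPosMeasure_stdGaussian (E := E)
  have h1 : Ψ (heat r (jointMap L f) (s • s⁻¹ • x)) - heat r (Ψ ∘ jointMap L f) (s • s⁻¹ • x) = 0 :=
    congrFun ((Continuous.ae_eq_iff_eq _ ((c2.comp (continuous_const_smul s)).sub
    (c1.comp (continuous_const_smul s))) continuous_const).1 h0) (s⁻¹ • x)
  simp only [smul_smul, mul_inv_cancel₀ hs, one_smul, sub_eq_zero] at h1
  exact h1.symm

/-- Equality in Jensen's inequality forces the second variation along the gradients to vanish. -/
theorem gaussianSecondVariation_gradient_eq_zero {L : Fin k → E →L[ℝ] V}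
    (hL : ∀ i, L i ∘L (L i).adjoint = ContinuousLinearMap.id ℝ V) {Ψ : (Fin k → ℝ) → ℝ}
    (hΨ : Continuous Ψ) {C₀ : ℝ} (hC₀ : ∀ x, |Ψ x| ≤ C₀)
    (hΨ2 : ContDiffOn ℝ 2 Ψ (openUnitCube k))
    (hneg : ∀ p ∈ openUnitCube k, ∀ w, gaussianSecondVariation L Ψ p w ≤ 0)
    {f : Fin k → V → ℝ} (hf : ∀ i, Measurable (f i))
    (hf01 : ∀ i x, f i x ∈ Set.Icc (0 : ℝ) 1)
    (heq : heat 1 (Ψ ∘ jointMap L f) 0 = Ψ (heat 1 (jointMap L f) 0))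
    {r : ℝ} (hr0 : 0 < r) (hr1 : r < 1) (x : E)
    (hx : ContDiffWithinAt ℝ 2 Ψ (unitCube k) (heat r (jointMap L f) x)) :
    gaussianSecondVariation L Ψ (heat r (jointMap L f) x)
      (fun i => gradient (heat r (f i)) (L i x)) = 0 := by
  have hF := stronglyMeasurable_jointMap L hf
  have hFC := norm_jointMap_le L hf01
  have hΨF : StronglyMeasurable (Ψ ∘ jointMap L f) := hΨ.comp_stronglyMeasurable hF
  have hΨFC : ∀ x, ‖(Ψ ∘ jointMap L f) x‖ ≤ C₀ := fun x => hC₀ _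
  have hE : ∀ {r : ℝ}, 0 < r → r < 1 → ∀ x,
      heat r (Ψ ∘ jointMap L f) x = Ψ (heat r (jointMap L f) x) :=
    fun h0 h1 => heat_comp_jointMap_eq hL hΨ hC₀ hΨ2 hneg hf hf01 heq h0 h1
  obtain ⟨M, hM0, hM⟩ := exists_lipschitz_heat hF hFC hr0
  have hlim := tendsto_heat_defect_div hΨ convex_unitCube uniqueDiffOn_unitCube isClosed_unitCube
    (fun x _ => hC₀ x) (fun x => heat_mem_of_convex hF hFC convex_unitCube isClosed_unitCube
      (jointMap_mem_unitCube L hf01) r x) (norm_heat_le hFC r) hM0 hM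
    (hasStrictFDerivAt_heat hF hFC hr0 x) hx (l := 𝓝[>] (0 : ℝ)) (h := id) (z := fun _ => x)
    tendsto_id tendsto_const_nhds
  simp_rw [fderiv_heat_jointMap hL hf hf01 hr0] at hlim
  -- For `0 < h < 1 - r` the defect vanishes exactly: `Ψ` commutes with the flow at times `r` and `h
  -- + r`, both below `1`. So the limit in the expansion is zero.
  refine tendsto_nhds_unique hlim (Tendsto.congr' ?_ tendsto_const_nhds)
  filter_upwards [Ioo_mem_nhdsGT (sub_pos.2 hr1)] with h hh
  have e : Ψ ∘ heat r (jointMap L f) = heat r (Ψ ∘ jointMap L f) :=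
    funext fun x => (hE hr0 hr1 x).symm
  rw [id, e, ← heat_add hΨF hΨFC hh.1.le hr0.le, ← heat_add hF hFC hh.1.le hr0.le,
    hE (by linarith [hh.1]) (by linarith [hh.2]), sub_self, mul_zero]

end JointMaps

/-! ### The Hessian within the cube, up to the boundary. -/

section CubeHessian

variable {k : ℕ}

theorem cubeHessian_apply (Ψ : (Fin k → ℝ) → ℝ) {p : Fin k → ℝ} (hp : p ∈ unitCube k)
    (i j : Fin k) :
    cubeHessian Ψ p i j = fderivWithin ℝ (fderivWithin ℝ Ψ (unitCube k)) (unitCube k) p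
      (Pi.single i 1) (Pi.single j 1) := by
  simp [cubeHessian, iteratedFDerivWithin_two_apply Ψ uniqueDiffOn_unitCube hp]

theorem second_fderivWithin_unitCube_apply (Ψ : (Fin k → ℝ) → ℝ) {p : Fin k → ℝ}
    (hp : p ∈ unitCube k) (v : Fin k → ℝ) :
    fderivWithin ℝ (fderivWithin ℝ Ψ (unitCube k)) (unitCube k) p v v
      = ∑ i, ∑ j, cubeHessian Ψ p i j * (v i * v j) := by
  simp_rw [cubeHessian_apply Ψ hp]
  conv_lhs => rw [pi_eq_sum_univ' v]
  simp only [map_sum, map_smul, sum_apply, smul_apply, smul_eq_mul, Finset.mul_sum]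
  rw [Finset.sum_comm]
  exact Finset.sum_congr rfl fun i _ => Finset.sum_congr rfl fun j _ => by ring

theorem cubeHessian_congr {Ψ Ψ' : (Fin k → ℝ) → ℝ} (h : Set.EqOn Ψ' Ψ (unitCube k))
    {p : Fin k → ℝ} (hp : p ∈ unitCube k) : cubeHessian Ψ' p = cubeHessian Ψ p := by
  unfold cubeHessian
  rw [iteratedFDerivWithin_congr h hp]

theorem mem_closure_openUnitCube {p : Fin k → ℝ} (hp : p ∈ unitCube k) :
    p ∈ closure (openUnitCube k) := by
  rw [← interior_unitCube, convex_unitCube.closure_interior_eq_closure_of_nonempty_interior]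
  · exact subset_closure hp
  · rw [interior_unitCube]; exact openUnitCube_nonempty

theorem tendsto_cubeHessian {Ψ : (Fin k → ℝ) → ℝ} {p : Fin k → ℝ} (hp : p ∈ unitCube k)
    (hΨ : ContDiffWithinAt ℝ 2 Ψ (unitCube k) p) (i j : Fin k) :
    Tendsto (fun q => cubeHessian Ψ q i j) (𝓝[openUnitCube k] p) (𝓝 (cubeHessian Ψ p i j)) := by
  have h1 : ContDiffWithinAt ℝ 0 (fderivWithin ℝ (fderivWithin ℝ Ψ (unitCube k)) (unitCube k))
      (unitCube k) p :=
    (hΨ.fderivWithin_right (m := 1) uniqueDiffOn_unitCube (by norm_num) hp).fderivWithin_right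
      uniqueDiffOn_unitCube (by norm_num) hp
  have h2 := ((h1.continuousWithinAt.clm_apply
    (continuousWithinAt_const (b := Pi.single i 1))).clm_apply
      (continuousWithinAt_const (b := Pi.single j 1))).mono openUnitCube_subset_unitCube
  rw [cubeHessian_apply Ψ hp]
  refine Tendsto.congr' ?_ h2
  filter_upwards [self_mem_nhdsWithin] with q hq
  rw [cubeHessian_apply Ψ (openUnitCube_subset_unitCube hq)]

/-- Semidefiniteness is a closed condition: `p` is a limit of interior points, along which the
one-sided Hessian is continuous. -/
theorem posSemidef_neg_hadamard_cubeHessian {M : Matrix (Fin k) (Fin k) ℝ}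
    {Ψ : (Fin k → ℝ) → ℝ} (hneg : ∀ x ∈ openUnitCube k, (-(M ⊙ cubeHessian Ψ x)).PosSemidef)
    {p : Fin k → ℝ} (hp : p ∈ unitCube k) (hΨ : ContDiffWithinAt ℝ 2 Ψ (unitCube k) p) :
    (-(M ⊙ cubeHessian Ψ p)).PosSemidef := by
  have : (𝓝[openUnitCube k] p).NeBot := mem_closure_iff_nhdsWithin_neBot.1
    (mem_closure_openUnitCube hp)
  have hlim : Tendsto (fun q => -(M ⊙ cubeHessian Ψ q)) (𝓝[openUnitCube k] p)
      (𝓝 (-(M ⊙ cubeHessian Ψ p))) := by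
    refine tendsto_pi_nhds.2 fun i => tendsto_pi_nhds.2 fun j => ?_
    exact ((tendsto_cubeHessian hp hΨ i j).const_mul (M i j)).neg
  have hev : ∀ᶠ q in 𝓝[openUnitCube k] p, (-(M ⊙ cubeHessian Ψ q)).PosSemidef := by
    filter_upwards [self_mem_nhdsWithin] with q hq using hneg q hq
  refine Matrix.PosSemidef.of_dotProduct_mulVec_nonneg ?_ fun x => ?_
  · have hc : Continuous fun A : Matrix (Fin k) (Fin k) ℝ => Aᴴ := by fun_prop
    exact tendsto_nhds_unique (((hc.tendsto _).comp hlim).congr' (hev.mono fun q hq => hq.1)) hlim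
  · have hc : Continuous fun A : Matrix (Fin k) (Fin k) ℝ => star x ⬝ᵥ (A *ᵥ x) := by fun_prop
    exact ge_of_tendsto ((hc.tendsto _).comp hlim)
      (hev.mono fun q hq => hq.dotProduct_mulVec_nonneg x)

end CubeHessian

/-! ### Matrices as maps of Euclidean spaces. -/

section MatrixMaps

variable {ι κ μ : Type*} [Fintype ι] [Fintype κ] [Fintype μ]

/-- A rectangular matrix as a continuous linear map between Euclidean spaces. -/
noncomputable def euclideanCLM [DecidableEq κ] (A : Matrix ι κ ℝ) :
    EuclideanSpace ℝ κ →L[ℝ] EuclideanSpace ℝ ι :=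
  LinearMap.toContinuousLinearMap (Matrix.toEuclideanLin A)

theorem euclideanCLM_apply [DecidableEq κ] (A : Matrix ι κ ℝ) (z : EuclideanSpace ℝ κ) :
    euclideanCLM A z = matApply A z := rfl

theorem adjoint_euclideanCLM [DecidableEq ι] [DecidableEq κ] (A : Matrix ι κ ℝ) :
    (euclideanCLM A).adjoint = euclideanCLM Aᵀ := by
  symm
  rw [ContinuousLinearMap.eq_adjoint_iff]
  intro x y
  have := Matrix.toEuclideanLin_conjTranspose_eq_adjoint A
  rw [Matrix.conjTranspose_eq_transpose_of_trivial] at this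
  change ⟪Matrix.toEuclideanLin Aᵀ x, y⟫ = ⟪x, Matrix.toEuclideanLin A y⟫
  rw [this, LinearMap.adjoint_inner_left]

theorem euclideanCLM_comp [DecidableEq κ] [DecidableEq μ] (A : Matrix ι κ ℝ) (B : Matrix κ μ ℝ) :
    euclideanCLM A ∘L euclideanCLM B = euclideanCLM (A * B) := by
  ext x
  simp [euclideanCLM_apply, matApply, Matrix.mulVec_mulVec]

end MatrixMaps

/-! ### Row blocks of the square root and the form `M ⊙ H_Ψ`. -/

section RowBlocks

variable {k n : ℕ}

/-- This is block `(i, j)` of `Q Qᵀ = Q² = M ⊗ I_n`: the source both of the coisometry property (`i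
= j`) and of the factor `m_ij` in the Hadamard product. -/
theorem rowBlock_mul_transpose {M : Matrix (Fin k) (Fin k) ℝ}
    {Q : Matrix (Fin k × Fin n) (Fin k × Fin n) ℝ} (hQ : Qᵀ = Q)
    (hQsq : Q * Q = M ⊗ₖ (1 : Matrix (Fin n) (Fin n) ℝ)) (i j : Fin k) :
    rowBlock Q i * (rowBlock Q j)ᵀ = M i j • 1 := by
  ext a b
  have h1 : (rowBlock Q i * (rowBlock Q j)ᵀ) a b = (Q * Qᵀ) (i, a) (j, b) := rfl
  rw [h1, hQ, hQsq]
  simp [Matrix.kroneckerMap_apply]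

theorem inner_adjoint_rowBlock {M : Matrix (Fin k) (Fin k) ℝ}
    {Q : Matrix (Fin k × Fin n) (Fin k × Fin n) ℝ} (hQ : Qᵀ = Q)
    (hQsq : Q * Q = M ⊗ₖ (1 : Matrix (Fin n) (Fin n) ℝ)) (i j : Fin k)
    (u v : EuclideanSpace ℝ (Fin n)) :
    ⟪(euclideanCLM (rowBlock Q i)).adjoint u, (euclideanCLM (rowBlock Q j)).adjoint v⟫
      = M i j * ⟪u, v⟫ := by
  rw [ContinuousLinearMap.adjoint_inner_left, adjoint_euclideanCLM,
    ← ContinuousLinearMap.comp_apply, euclideanCLM_comp, rowBlock_mul_transpose hQ hQsq,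
    euclideanCLM_apply, matApply, Matrix.smul_mulVec, Matrix.one_mulVec, WithLp.toLp_smul,
    WithLp.toLp_ofLp, real_inner_smul_right]

theorem rowBlock_coisometry {M : Matrix (Fin k) (Fin k) ℝ} (hMdiag : ∀ i, M i i = 1)
    {Q : Matrix (Fin k × Fin n) (Fin k × Fin n) ℝ} (hQ : Qᵀ = Q)
    (hQsq : Q * Q = M ⊗ₖ (1 : Matrix (Fin n) (Fin n) ℝ)) (i : Fin k) :
    euclideanCLM (rowBlock Q i) ∘L (euclideanCLM (rowBlock Q i)).adjoint
      = ContinuousLinearMap.id ℝ _ := by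
  rw [adjoint_euclideanCLM, euclideanCLM_comp, rowBlock_mul_transpose hQ hQsq, hMdiag, one_smul]
  ext x
  simp [euclideanCLM_apply, matApply]

/-- The second variation is a sum over the `n` coordinates of values of the quadratic form
`M ⊙ H_Ψ`. -/
theorem gaussianSecondVariation_rowBlock {M : Matrix (Fin k) (Fin k) ℝ}
    {Q : Matrix (Fin k × Fin n) (Fin k × Fin n) ℝ} (hQ : Qᵀ = Q)
    (hQsq : Q * Q = M ⊗ₖ (1 : Matrix (Fin n) (Fin n) ℝ)) (Ψ : (Fin k → ℝ) → ℝ)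
    {p : Fin k → ℝ} (hp : p ∈ unitCube k) (w : Fin k → EuclideanSpace ℝ (Fin n)) :
    gaussianSecondVariation (fun i => euclideanCLM (rowBlock Q i)) Ψ p w
      = 2⁻¹ * ∑ a, (fun i => w i a) ⬝ᵥ ((M ⊙ cubeHessian Ψ p) *ᵥ fun i => w i a) := by
  set L : Fin k → EuclideanSpace ℝ (Fin k × Fin n) →L[ℝ] EuclideanSpace ℝ (Fin n) :=
    fun i => euclideanCLM (rowBlock Q i)
  have hterm : ∀ i j, Integrable (fun y => cubeHessian Ψ p i j * (⟪w i, L i y⟫ * ⟪w j, L j y⟫))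
      (stdGaussian (EuclideanSpace ℝ (Fin k × Fin n))) := by
    intro i j
    refine Integrable.const_mul ?_ _
    refine (integrable_sq_norm_stdGaussian.const_mul
      (‖w i‖ * ‖L i‖ * (‖w j‖ * ‖L j‖))).mono'
      (Continuous.aestronglyMeasurable (by fun_prop)) (.of_forall fun y => ?_)
    have h : ∀ i, ‖⟪w i, L i y⟫‖ ≤ ‖w i‖ * ‖L i‖ * ‖y‖ := fun i =>
      (norm_inner_le_norm _ _).trans (by rw [mul_assoc]; gcongr; exact (L i).le_opNorm y)
    calc ‖⟪w i, L i y⟫ * ⟪w j, L j y⟫‖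
        ≤ (‖w i‖ * ‖L i‖ * ‖y‖) * (‖w j‖ * ‖L j‖ * ‖y‖) := by
          rw [norm_mul]; exact mul_le_mul (h i) (h j) (norm_nonneg _) (by positivity)
      _ = _ := by ring
  have hval : ∀ i j, ∫ y, ⟪w i, L i y⟫ * ⟪w j, L j y⟫
      ∂(stdGaussian (EuclideanSpace ℝ (Fin k × Fin n))) = M i j * ∑ a, w i a * w j a := by
    intro i j
    have := integral_inner_mul_inner_stdGaussian ((L i).adjoint (w i)) ((L j).adjoint (w j))
    simp only [ContinuousLinearMap.adjoint_inner_left (L i),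
      ContinuousLinearMap.adjoint_inner_left (L j)] at this
    rw [this, ← ContinuousLinearMap.adjoint_inner_left, inner_adjoint_rowBlock hQ hQsq,
      PiLp.inner_apply]
    simp [mul_comm]
  rw [gaussianSecondVariation, integral_const_mul]
  simp_rw [second_fderivWithin_unitCube_apply Ψ hp]
  rw [integral_finsetSum _ fun i _ => integrable_finsetSum _ fun j _ => hterm i j]
  congr 1
  have e1 : ∀ i, ∫ y, ∑ j, cubeHessian Ψ p i j * (⟪w i, L i y⟫ * ⟪w j, L j y⟫)
      ∂(stdGaussian (EuclideanSpace ℝ (Fin k × Fin n)))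
      = ∑ j, ∑ a, w i a * (M i j * cubeHessian Ψ p i j * w j a) := by
    intro i
    rw [integral_finsetSum _ fun j _ => hterm i j]
    refine Finset.sum_congr rfl fun j _ => ?_
    rw [integral_const_mul, hval, Finset.mul_sum, Finset.mul_sum]
    exact Finset.sum_congr rfl fun a _ => by ring
  simp only [e1, dotProduct, Matrix.mulVec, Matrix.hadamard_apply, Finset.mul_sum]
  symm
  rw [Finset.sum_comm]
  exact Finset.sum_congr rfl fun i _ => Finset.sum_comm

theorem gaussianSecondVariation_rowBlock_nonpos {M : Matrix (Fin k) (Fin k) ℝ}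
    {Q : Matrix (Fin k × Fin n) (Fin k × Fin n) ℝ} (hQ : Qᵀ = Q)
    (hQsq : Q * Q = M ⊗ₖ (1 : Matrix (Fin n) (Fin n) ℝ)) {Ψ : (Fin k → ℝ) → ℝ}
    {p : Fin k → ℝ} (hp : p ∈ unitCube k) (hA : (-(M ⊙ cubeHessian Ψ p)).PosSemidef)
    (w : Fin k → EuclideanSpace ℝ (Fin n)) :
    gaussianSecondVariation (fun i => euclideanCLM (rowBlock Q i)) Ψ p w ≤ 0 := by
  rw [gaussianSecondVariation_rowBlock hQ hQsq Ψ hp]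
  refine mul_nonpos_of_nonneg_of_nonpos (by norm_num) (Finset.sum_nonpos fun a _ => ?_)
  have := hA.dotProduct_mulVec_nonneg fun i => w i a
  simpa [Matrix.neg_mulVec] using this

/-- A vanishing sum of `n` nonpositive terms has every term zero, and a null vector of a
semidefinite form lies in its kernel; the Kronecker factor `I_n` just runs this over the
coordinates. -/
theorem kronecker_mulVec_eq_zero_of_gaussianSecondVariation_eq_zero
    {M : Matrix (Fin k) (Fin k) ℝ}
    {Q : Matrix (Fin k × Fin n) (Fin k × Fin n) ℝ} (hQ : Qᵀ = Q)
    (hQsq : Q * Q = M ⊗ₖ (1 : Matrix (Fin n) (Fin n) ℝ)) {Ψ : (Fin k → ℝ) → ℝ}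
    {p : Fin k → ℝ} (hp : p ∈ unitCube k) (hA : (-(M ⊙ cubeHessian Ψ p)).PosSemidef)
    {w : Fin k → EuclideanSpace ℝ (Fin n)}
    (h0 : gaussianSecondVariation (fun i => euclideanCLM (rowBlock Q i)) Ψ p w = 0) :
    ((M ⊙ cubeHessian Ψ p) ⊗ₖ (1 : Matrix (Fin n) (Fin n) ℝ)) *ᵥ (fun q => w q.1 q.2) = 0 := by
  rw [gaussianSecondVariation_rowBlock hQ hQsq Ψ hp, mul_eq_zero_iff_left (by norm_num)] at h0
  set A := M ⊙ cubeHessian Ψ p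
  have hle : ∀ a ∈ Finset.univ, (fun i => w i a) ⬝ᵥ (A *ᵥ fun i => w i a) ≤ 0 := fun a _ => by
    have := hA.dotProduct_mulVec_nonneg fun i => w i a
    simpa [Matrix.neg_mulVec] using this
  have hz : ∀ a, A *ᵥ (fun i => w i a) = 0 := fun a => by
    have h1 := (Finset.sum_eq_zero_iff_of_nonpos hle).1 h0 a (Finset.mem_univ a)
    have h2 := (hA.dotProduct_mulVec_zero_iff fun i => w i a).1
      (by simpa [Matrix.neg_mulVec] using h1)
    simpa [Matrix.neg_mulVec] using h2
  funext q
  have h1 := congrFun (hz q.2) q.1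
  simp only [Matrix.mulVec, dotProduct, Pi.zero_apply] at h1 ⊢
  rw [Fintype.sum_prod_type]
  simpa [Matrix.kroneckerMap_apply, Matrix.one_apply] using h1

end RowBlocks

/-! ### Extending `Ψ` beyond the cube. -/

section CubeExtension

variable {k : ℕ}

/-- The coordinatewise projection of `ℝ^k` onto `[0,1]^k`. -/
noncomputable def cubeProj (x : Fin k → ℝ) : Fin k → ℝ := fun i => max 0 (min 1 (x i))

theorem continuous_cubeProj : Continuous (cubeProj (k := k)) := by
  unfold cubeProj; fun_prop

theorem cubeProj_mem (x : Fin k → ℝ) : cubeProj x ∈ unitCube k := fun _ =>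
  ⟨le_max_left _ _, max_le zero_le_one (min_le_left _ _)⟩

theorem cubeProj_of_mem {x : Fin k → ℝ} (hx : x ∈ unitCube k) : cubeProj x = x := by
  funext i
  rw [cubeProj, min_eq_right (hx i).2, max_eq_right (hx i).1]

theorem exists_bounded_continuous_extension {Ψ : (Fin k → ℝ) → ℝ}
    (hΨ : ContinuousOn Ψ (unitCube k)) :
    ∃ Ψ' : (Fin k → ℝ) → ℝ, Continuous Ψ' ∧ Set.EqOn Ψ' Ψ (unitCube k) ∧
      ∃ C, ∀ x, |Ψ' x| ≤ C := by
  have hc : IsCompact (unitCube k) := by rw [unitCube_eq_Icc]; exact isCompact_Icc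
  obtain ⟨C, hC⟩ := hc.exists_bound_of_continuousOn hΨ
  refine ⟨Ψ ∘ cubeProj, hΨ.comp_continuous continuous_cubeProj cubeProj_mem, fun x hx => ?_, C,
    fun x => hC _ (cubeProj_mem x)⟩
  simp [cubeProj_of_mem hx]

end CubeExtension

/-! ### From the heat semigroup to the Ornstein-Uhlenbeck semigroup. -/

section OrnsteinUhlenbeck

theorem differentiable_ouSemigroup {ι : Type*} [Fintype ι] {t : ℝ} (ht : 0 < t)
    {f : EuclideanSpace ℝ ι → ℝ} (hf : Measurable f) (hf01 : ∀ x, f x ∈ Set.Icc (0 : ℝ) 1) :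
    Differentiable ℝ (ouSemigroup t f) := by
  have hr : 0 < 1 - Real.exp (-2 * t) := by
    rw [sub_pos, Real.exp_lt_one_iff]; linarith
  exact ((contDiff_heat hf.stronglyMeasurable (fun x => norm_le_one_of_mem_Icc (hf01 x))
    hr).differentiable one_ne_zero).comp
      (show Differentiable ℝ fun x : EuclideanSpace ℝ ι => Real.exp (-t) • x by fun_prop)

theorem gradient_ouSemigroup {ι : Type*} [Fintype ι] (t : ℝ) (f : EuclideanSpace ℝ ι → ℝ)
    (x : EuclideanSpace ℝ ι) :
    gradient (ouSemigroup t f) x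
      = Real.exp (-t) • gradient (heat (1 - Real.exp (-2 * t)) f) (Real.exp (-t) • x) := by
  have : ouSemigroup t f
      = fun x => heat (1 - Real.exp (-2 * t)) f (Real.exp (-t) • x) := rfl
  rw [gradient, this, fderiv_comp_smul, gradient]
  simp

theorem ouVec_eq_heat {k n : ℕ} (t : ℝ) {f : Fin k → EuclideanSpace ℝ (Fin n) → ℝ}
    (hf : ∀ i, Measurable (f i)) (hf01 : ∀ i x, f i x ∈ Set.Icc (0 : ℝ) 1)
    {Q : Matrix (Fin k × Fin n) (Fin k × Fin n) ℝ}
    (hL : ∀ i, euclideanCLM (rowBlock Q i) ∘L (euclideanCLM (rowBlock Q i)).adjoint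
      = ContinuousLinearMap.id ℝ _) (z : EuclideanSpace ℝ (Fin k × Fin n)) :
    ouVec t f Q z = heat (1 - Real.exp (-2 * t))
      (jointMap (fun i => euclideanCLM (rowBlock Q i)) f) (Real.exp (-t) • z) := by
  rw [heat_jointMap hL hf hf01]
  funext i
  exact heat_comp_coisometry (hL i) (hf i) _ _

theorem gradVec_eq {k n : ℕ} (t : ℝ) (f : Fin k → EuclideanSpace ℝ (Fin n) → ℝ)
    (Q : Matrix (Fin k × Fin n) (Fin k × Fin n) ℝ) (z : EuclideanSpace ℝ (Fin k × Fin n)) :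
    gradVec t f Q z = Real.exp (-t) • fun q : Fin k × Fin n =>
      gradient (heat (1 - Real.exp (-2 * t)) (f q.1))
        (euclideanCLM (rowBlock Q q.1) (Real.exp (-t) • z)) q.2 := by
  funext q
  simp [gradVec, compMat, gradient_ouSemigroup, ← euclideanCLM_apply]

end OrnsteinUhlenbeck

/-! ### The Gaussian vector as a linear image of a standard one. -/

section MultivariateGaussian

open scoped MatrixOrder in
theorem multivariateGaussian_zero_eq_map {ι : Type*} [Fintype ι] [DecidableEq ι]
    {Q S : Matrix ι ι ℝ} (hQ : Q.PosSemidef) (hQS : Q * Q = S) :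
    multivariateGaussian 0 S = (stdGaussian (EuclideanSpace ℝ ι)).map (euclideanCLM Q) := by
  rw [multivariateGaussian, CFC.sqrt_unique hQS hQ.nonneg]
  congr 1
  funext x
  rw [zero_add]
  rfl

theorem integral_hasLaw_multivariateGaussian {ι G : Type*} [Fintype ι] [DecidableEq ι]
    [NormedAddCommGroup G] [NormedSpace ℝ G] {Q S : Matrix ι ι ℝ} (hQ : Q.PosSemidef)
    (hQS : Q * Q = S) {Ω : Type*} [MeasurableSpace Ω] {P : Measure Ω}
    {X : Ω → EuclideanSpace ℝ ι} (hX : HasLaw X (multivariateGaussian 0 S) P)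
    {g : EuclideanSpace ℝ ι → G} (hg : StronglyMeasurable g) :
    ∫ ω, g (X ω) ∂P = ∫ y, g (euclideanCLM Q y) ∂(stdGaussian (EuclideanSpace ℝ ι)) := by
  have := hX.integral_comp hg.aestronglyMeasurable
  rw [multivariateGaussian_zero_eq_map hQ hQS,
    integral_map (by fun_prop) hg.aestronglyMeasurable] at this
  exact this

end MultivariateGaussian

/-! ### Assembly: the kernel identity in the equality case. -/

theorem corollary6 {k n : ℕ}
    -- a positive definite correlation matrix `M`
    (M : Matrix (Fin k) (Fin k) ℝ) (hM : M.PosDef) (hMdiag : ∀ i, M i i = 1)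
    -- the positive definite square root `Q` of `M ⊗ I_n`
    (Q : Matrix (Fin k × Fin n) (Fin k × Fin n) ℝ) (hQ : Q.PosDef)
    (hQsq : Q * Q = M ⊗ₖ (1 : Matrix (Fin n) (Fin n) ℝ))
    -- a centred Gaussian vector `X = (X_1, …, X_k)` with covariance `M ⊗ I_n`
    {Ω : Type*} [MeasurableSpace Ω] (P : Measure Ω)
    (X : Ω → EuclideanSpace ℝ (Fin k × Fin n))
    (hX : HasLaw X (multivariateGaussian 0 (M ⊗ₖ (1 : Matrix (Fin n) (Fin n) ℝ))) P)
    -- `Ψ` on `[0,1]^k`: continuous, `C²` inside, with `M ⊙ H_Ψ ≤ 0`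
    (Ψ : (Fin k → ℝ) → ℝ) (hΨcont : ContinuousOn Ψ (unitCube k))
    (hΨdiff : ContDiffOn ℝ 2 Ψ (openUnitCube k))
    (hΨ : ∀ x ∈ openUnitCube k, (-(M ⊙ cubeHessian Ψ x)).PosSemidef)
    -- measurable `F = (f_1, …, f_k)` with values in `[0,1]^k`
    (f : Fin k → EuclideanSpace ℝ (Fin n) → ℝ) (hf : ∀ i, Measurable (f i))
    (hf01 : ∀ i x, f i x ∈ Set.Icc (0 : ℝ) 1)
    -- `E Ψ(F(X)) = Ψ(E F(X))`
    (heq : ∫ ω, Ψ (fun i => f i (block i (X ω))) ∂P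
      = Ψ (fun i => ∫ ω, f i (block i (X ω)) ∂P))
    (t : ℝ) (ht : 0 < t) :
    -- the gradients exist,
    (∀ i, Differentiable ℝ (ouSemigroup t (f i))) ∧
    -- and the kernel identity holds wherever `H_Ψ(P_t F^Q)` is defined: at every `z` with
    -- `P_t F^Q (z)` in the open cube, and at boundary values near which `Ψ` is `C²`
    ∀ z : EuclideanSpace ℝ (Fin k × Fin n),
      (ouVec t f Q z ∈ openUnitCube k ∨ ContDiffWithinAt ℝ 2 Ψ (unitCube k) (ouVec t f Q z)) →
      ((M ⊙ cubeHessian Ψ (ouVec t f Q z)) ⊗ₖ (1 : Matrix (Fin n) (Fin n) ℝ)) *ᵥ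
        gradVec t f Q z = 0 := by
  refine ⟨fun i => differentiable_ouSemigroup ht (hf i) (hf01 i), fun z hz => ?_⟩
  have hQt : Qᵀ = Q := by
    rw [← Matrix.conjTranspose_eq_transpose_of_trivial]; exact hQ.1
  set L : Fin k → EuclideanSpace ℝ (Fin k × Fin n) →L[ℝ] EuclideanSpace ℝ (Fin n) :=
    fun i => euclideanCLM (rowBlock Q i)
  have hL : ∀ i, L i ∘L (L i).adjoint = ContinuousLinearMap.id ℝ _ :=
    rowBlock_coisometry hMdiag hQt hQsq
  -- The heat-flow lemmas want a globally continuous bounded function. All derivatives are taken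
  -- within the cube, so the extension has the same Hessian there.
  obtain ⟨Ψ', hΨ', hEq, C₀, hC₀⟩ := exists_bounded_continuous_extension hΨcont
  have hF01 := jointMap_mem_unitCube L hf01
  have hFm := stronglyMeasurable_jointMap L hf
  have hF1 := norm_jointMap_le L hf01
  have hheat : ∀ r x, heat r (jointMap L f) x ∈ unitCube k := fun r x =>
    heat_mem_of_convex hFm hF1 convex_unitCube isClosed_unitCube hF01 r x
  have hΨ'diff : ContDiffOn ℝ 2 Ψ' (openUnitCube k) :=
    hΨdiff.congr fun x hx => hEq (openUnitCube_subset_unitCube hx)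
  have hblock : ∀ i y, block i (euclideanCLM Q y) = L i y := fun i y => rfl
  have hblockm : ∀ i : Fin k, Measurable (block (n := n) i) := fun i => by
    unfold block; fun_prop
  have hmeasF : Measurable fun x : EuclideanSpace ℝ (Fin k × Fin n) =>
      fun i => f i (block i x) := measurable_pi_lambda _ fun i => (hf i).comp (hblockm i)
  have heq' : heat 1 (Ψ' ∘ jointMap L f) 0 = Ψ' (heat 1 (jointMap L f) 0) := by
    have e1 : ∫ ω, Ψ (fun i => f i (block i (X ω))) ∂P = heat 1 (Ψ' ∘ jointMap L f) 0 := by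
      have h1 : ∀ ω, Ψ (fun i => f i (block i (X ω))) = Ψ' (fun i => f i (block i (X ω))) :=
        fun ω => (hEq fun i => hf01 i _).symm
      simp_rw [h1]
      rw [integral_hasLaw_multivariateGaussian hQ.posSemidef hQsq hX
        (g := fun x => Ψ' fun i => f i (block i x))
        (hΨ'.comp_stronglyMeasurable hmeasF.stronglyMeasurable)]
      simp only [heat, Real.sqrt_one, one_smul, zero_add]
      rfl
    have e2 : (fun i => ∫ ω, f i (block i (X ω)) ∂P) = heat 1 (jointMap L f) 0 := by
      rw [heat_jointMap hL hf hf01]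
      funext i
      rw [integral_hasLaw_multivariateGaussian hQ.posSemidef hQsq hX
        (g := fun x => f i (block i x)) ((hf i).comp (hblockm i)).stronglyMeasurable, jointMap,
        ← heat_comp_coisometry (hL i) (hf i)]
      simp only [heat, Real.sqrt_one, one_smul, zero_add]
      rfl
    rw [← e1, ← e2, heq, ← hEq]
    rw [e2]
    exact hheat _ _
  have hneg : ∀ p ∈ openUnitCube k, ∀ w, gaussianSecondVariation L Ψ' p w ≤ 0 := fun p hp w => by
    have hp' := openUnitCube_subset_unitCube hp
    refine gaussianSecondVariation_rowBlock_nonpos hQt hQsq hp' ?_ w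
    rw [cubeHessian_congr hEq hp']
    exact hΨ p hp
  have hr0 : 0 < 1 - Real.exp (-2 * t) := by
    rw [sub_pos, Real.exp_lt_one_iff]; linarith
  -- Strictness leaves the time `1 - r > 0` in which the defect of `heat r` is known to vanish.
  have hr1 : 1 - Real.exp (-2 * t) < 1 := sub_lt_self _ (Real.exp_pos _)
  rw [ouVec_eq_heat t hf hf01 hL] at hz ⊢
  have hpmem := hheat (1 - Real.exp (-2 * t)) (Real.exp (-t) • z)
  have hz2 : ContDiffWithinAt ℝ 2 Ψ (unitCube k)
      (heat (1 - Real.exp (-2 * t)) (jointMap L f) (Real.exp (-t) • z)) :=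
    hz.elim (fun h => contDiffWithinAt_unitCube hΨdiff h) id
  have h0 := gaussianSecondVariation_gradient_eq_zero hL hΨ' hC₀ hΨ'diff hneg hf hf01 heq' hr0 hr1
    (Real.exp (-t) • z) (hz2.congr (fun x hx => hEq hx) (hEq hpmem))
  have hA := posSemidef_neg_hadamard_cubeHessian hΨ hpmem hz2
  rw [← cubeHessian_congr hEq hpmem] at hA ⊢
  rw [gradVec_eq, Matrix.mulVec_smul,
    kronecker_mulVec_eq_zero_of_gaussianSecondVariation_eq_zero hQt hQsq hpmem hA h0, smul_zero]
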